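/- Fix an integer $K\ge 2$. For an integer $n\ge 2$ let $d=n^K$ and $\mathcal H_d=(\mathbb C^n)^{\otimes K}$. Let $\pi_{d}^{(K)*}$ be the following law of a state $\rho$ on $\mathcal H_d$: with probability $1/2$, $\rho=|\psi\rangle\langle\psi|$ for a Haar random pure state $|\psi\rangle\in\mathcal H_d$; with probability $1/2$, $\rho=\bigotimes_{k=1}^K|\psi_k\rangle\langle\psi_k|$ for independent Haar random pure states $|\psi_k\rangle\in\mathbb C^{n}=\mathbb C^{d^{1/K}}$. A Haar random pure state is $U|0\rangle$ with $U$ a Haar random unitary and $|0\rangle$ a fixed unit vector. A state $\rho$ on $\mathcal H_d$ is in $\mathrm{ENT}$ ($K$-partite entangled) if it cannot be written as $\sum_i p_i\,\rho_1^i\otimes\cdots\otimes\rho_K^i$ with $p_i\ge 0$, $\sum_i p_i=1$ and density matrices $\rho_k^i$ on $\mathbb C^n$. A single-copy adaptive entanglement detection protocol (EDP) with $T$ copies is a decision tree of depth $T$: at each step a POVM with finitely many outcomes on $\mathcal H_d$, chosen depending on all earlier outcomes, is applied to a fresh copy of $\rho$; after $T$ steps a real number $\hat C(\rho)$ is computed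 from the outcomes, and the protocol answers "entangled" if $\hat C(\rho)<0$. Then there are constants $c,C>0$ depending only on $K$ such that for every $n\ge 2$, with $d=n^K$: 1. every single-copy adaptive EDP with completeness $\Pr_{\rho\sim\pi_d^{(K)*}}[\hat C(\rho)<0]=\frac14$ and soundness $\Pr_{\rho\sim\pi_d^{(K)*}}[\rho\in\mathrm{ENT}\mid\hat C(\rho)<0]=\frac56$ uses $T\ge c\,d^{1/(2K)}$ copies of $\rho$; 2. there is a single-copy adaptive EDP with the same completeness $\frac14$ and soundness $\frac56$ that uses $T\le C\,d^{1/(2K)}$ copies of $\rho$. That is, the minimum number of copies required is $\Theta(d^{1/(2K)})$. -/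

import Mathlib

open MeasureTheory
open scoped ENNReal ComplexOrder

noncomputable section

namespace EntDetect

/-! ### Haar random pure states -/

/-- Matrices carry their Borel sigma-algebra. -/
instance matrixMeasurableSpace {ι κ : Type} : MeasurableSpace (Matrix ι κ ℂ) := borel _

instance matrixBorelSpace {ι κ : Type} : BorelSpace (Matrix ι κ ℂ) := ⟨rfl⟩

/-- The unitary group `U(ι)` is compact. -/
instance unitaryGroupCompact {ι : Type} [Fintype ι] [DecidableEq ι] :
    CompactSpace (Matrix.unitaryGroup ι ℂ) := by
  refine (isCompact_iff_compactSpace (s := ((Matrix.unitaryGroup ι ℂ :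
    Submonoid (Matrix ι ι ℂ)) : Set (Matrix ι ι ℂ)))).mp ?_
  have hclosed : IsClosed ((Matrix.unitaryGroup ι ℂ : Submonoid (Matrix ι ι ℂ)) :
      Set (Matrix ι ι ℂ)) := by
    have h : ((Matrix.unitaryGroup ι ℂ : Submonoid (Matrix ι ι ℂ)) : Set (Matrix ι ι ℂ))
        = {A : Matrix ι ι ℂ | A * star A = 1} := by
      ext A
      exact Matrix.mem_unitaryGroup_iff
    rw [h]
    exact isClosed_eq (by fun_prop) continuous_const
  have hball : IsCompact
      (Set.univ.pi fun _ : ι => Set.univ.pi fun _ : ι => Metric.closedBall (0 : ℂ) 1) :=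
    isCompact_univ_pi fun _ => isCompact_univ_pi fun _ => isCompact_closedBall _ _
  refine IsCompact.of_isClosed_subset hball hclosed ?_
  intro A hA i _ j _
  rw [mem_closedBall_zero_iff]
  exact entry_norm_bound_of_unitary hA i j

/-- The Haar probability measure on the unitary group `U(ι)`. -/
def haarUnitary (ι : Type) [Fintype ι] [DecidableEq ι] :
    Measure (Matrix.unitaryGroup ι ℂ) :=
  Measure.haarMeasure ⊤

/-- The law of the density matrix `|ψ⟩⟨ψ|` of a Haar random pure state `|ψ⟩ = U|o⟩`, where `U` is a
Haar random unitary and `|o⟩` is a fixed vector of the standard basis. -/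
def haarPure {ι : Type} [Fintype ι] [DecidableEq ι] (o : ι) : Measure (Matrix ι ι ℂ) :=
  (haarUnitary ι).map fun U : Matrix.unitaryGroup ι ℂ =>
    (U : Matrix ι ι ℂ) * Matrix.single o o (1 : ℂ) * (U : Matrix ι ι ℂ).conjTranspose

/-! ### Multipartite states

The `K`-fold tensor product of `ℂⁿ` is the space with standard basis indexed by
`Fin K → Fin n`; its dimension is `n ^ K`. -/

/-- The tensor product `A₁ ⊗ ⋯ ⊗ A_K` of matrices on `ℂⁿ`. -/
def tensor {K n : ℕ} (A : Fin K → Matrix (Fin n) (Fin n) ℂ) :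
    Matrix (Fin K → Fin n) (Fin K → Fin n) ℂ :=
  Matrix.of fun x y => ∏ k, A k (x k) (y k)

/-- Density matrices: positive semidefinite of trace one. -/
def IsDensity {ι : Type} [Fintype ι] (ρ : Matrix ι ι ℂ) : Prop :=
  ρ.PosSemidef ∧ ρ.trace = 1

/-- Fully separable `K`-partite states: convex combinations of product states. -/
def IsSeparable {K n : ℕ} (ρ : Matrix (Fin K → Fin n) (Fin K → Fin n) ℂ) : Prop :=
  ∃ (m : ℕ) (p : Fin m → ℝ) (σ : Fin m → Fin K → Matrix (Fin n) (Fin n) ℂ),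
    (∀ i, 0 ≤ p i) ∧ ∑ i, p i = 1 ∧ (∀ i k, IsDensity (σ i k)) ∧
      ρ = ∑ i, (p i : ℂ) • tensor (σ i)

/-- States with `K`-partite entanglement: those that are not of the separable form. -/
def IsEntangled {K n : ℕ} (ρ : Matrix (Fin K → Fin n) (Fin K → Fin n) ℂ) : Prop :=
  IsDensity ρ ∧ ¬ IsSeparable ρ

/-- The law of `ψ₁ ⊗ ⋯ ⊗ ψ_K` for independent Haar random pure states `ψ₁, …, ψ_K` of `ℂⁿ`. -/
def haarProduct (K n : ℕ) [NeZero n] :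
    Measure (Matrix (Fin K → Fin n) (Fin K → Fin n) ℂ) :=
  (Measure.pi fun _ : Fin K => haarPure (0 : Fin n)).map tensor

/-- The `K`-partite state distribution in total dimension `n ^ K`: with probability `1/2` a Haar
random pure state of the whole space, with probability `1/2` a product of `K` Haar random pure
states of the local spaces `ℂⁿ`. -/
def stateLaw (K n : ℕ) [NeZero n] : Measure (Matrix (Fin K → Fin n) (Fin K → Fin n) ℂ) :=
  (2⁻¹ : ℝ≥0∞) • haarPure (fun _ => 0 : Fin K → Fin n) + (2⁻¹ : ℝ≥0∞) • haarProduct K n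

/-! ### Single-copy adaptive protocols -/

/-- A POVM with `m` outcomes. -/
structure POVM (ι : Type) [Fintype ι] [DecidableEq ι] (m : ℕ) where
  elem : Fin m → Matrix ι ι ℂ
  posSemidef : ∀ i, (elem i).PosSemidef
  sum_eq_one : ∑ i, elem i = 1

/-- Single-copy adaptive detection protocols that consume `T` copies, as decision trees of depth
`T`: at each inner node a POVM, chosen according to the outcomes so far, is applied to one fresh
copy, and the outcome selects the child; a leaf carries the value of the detection
function `Ĉ`, computed from all the outcomes on the path to it. -/
inductive Protocol (ι : Type) [Fintype ι] [DecidableEq ι] : ℕ → Type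
  | leaf (value : ℝ) : Protocol ι 0
  | node {T m : ℕ} (M : POVM ι m) (next : Fin m → Protocol ι T) : Protocol ι (T + 1)

/-- The probability that the protocol, run on copies of the state `ρ`, ends in a leaf with
`Ĉ < 0`, that is, answers that `ρ` is entangled. Outcome `i` of a POVM `M` has
probability `Tr (M i ρ)`. -/
def Protocol.probNeg {ι : Type} [Fintype ι] [DecidableEq ι] (ρ : Matrix ι ι ℂ) :
    {T : ℕ} → Protocol ι T → ℝ
  | _, .leaf value => if value < 0 then 1 else 0
  | _, .node M next => ∑ i, ((M.elem i * ρ).trace).re * (next i).probNeg ρ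

/-- `Pr[Ĉ(ρ) < 0]` for `ρ` drawn from the `K`-partite state distribution. -/
def Protocol.completeness {K n : ℕ} [NeZero n] {T : ℕ} (P : Protocol (Fin K → Fin n) T) : ℝ :=
  ∫ ρ, P.probNeg ρ ∂(stateLaw K n)

/-- `Pr[ρ ∈ ENT | Ĉ(ρ) < 0]` for `ρ` drawn from the `K`-partite state distribution. -/
def Protocol.soundness {K n : ℕ} [NeZero n] {T : ℕ} (P : Protocol (Fin K → Fin n) T) : ℝ :=
  (∫ ρ in {ρ | IsEntangled ρ}, P.probNeg ρ ∂(stateLaw K n)) / P.completeness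

end EntDetect

end

namespace EntDetect

open Matrix

/-! ### Haar random vectors -/

/-! Let `a` and `b` be the mean acceptance probabilities of a protocol on Haar states and on random
product states (`meanHaar`, `meanProduct`). A Haar state is almost surely entangled and a product
state never is, so completeness 1/4 and soundness 5/6 mean exactly `a = 5/12` and `b = 1/12`
(`completeness_soundness_iff`). Since d^(1/(2K)) = √n, the question is how many copies separate the
two ensembles by a constant gap.

Lower bound. Both ensembles are compared with the maximally mixed state. The key is a correlation
inequality: for positive semidefinite M_1, …, M_T on ℂ^D and Haar random ψ, E ∏⟨ψ|M_i|ψ⟩ ≥ ∏ tr M_i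
/ (D(D+1)⋯(D+T-1)) (`prod_trace_le_integral_haarVec`). For a Gaussian vector z it reads E ∏⟨z|M_i|z⟩
≥ ∏ tr M_i, and it holds because multiplying a polynomial by the linear form v·z multiplies its
squared Fock norm by at least |v|² (`fockNormSq_linForm_mul`); homogeneity carries it to the sphere.
Partial traces and induction on the number of factors give the version for product vectors, with the
K-th power of the denominator for dimension n. The inequality is applied to each root-to-leaf path
of the decision tree, so adaptivity does not help: acceptance and rejection probabilities in either
ensemble are at least 1 - K T²/n times those in the maximally mixed state. Hence `a - b ≤ K T²/n`.

Upper bound. The first tensor factor of every copy is measured in the standard basis and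
coincidences between two halves of the sample are counted. The mean collision probability is 2/(n+1)
for product states and about 1/n for Haar states, so O(√n) samples suffice once n ≥ 10⁶
(`exists_collision_protocol`). The finitely many smaller n are handled by tomography, whose cost
goes into the constant. One extra copy pays for a random mixture with constant answers that makes
both probabilities exact (`exists_exact_protocol`). -/

instance haarUnitary_isProbabilityMeasure (ι : Type) [Fintype ι] [DecidableEq ι] :
    IsProbabilityMeasure (haarUnitary ι) := by
  constructor
  have h := Measure.haarMeasure_self (K₀ := (⊤ : TopologicalSpace.PositiveCompacts
    (Matrix.unitaryGroup ι ℂ)))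
  simpa [haarUnitary] using h

instance haarUnitary_isHaarMeasure (ι : Type) [Fintype ι] [DecidableEq ι] :
    (haarUnitary ι).IsHaarMeasure := by
  unfold haarUnitary; infer_instance

instance matrix_secondCountableTopology {ι κ : Type} [Countable ι] [Countable κ] :
    SecondCountableTopology (Matrix ι κ ℂ) :=
  inferInstanceAs (SecondCountableTopology (ι → κ → ℂ))

/-- Compact groups are unimodular: a right translate of the measure is again left Haar of mass one,
and uniqueness applies. -/
instance haarUnitary_isMulRightInvariant (ι : Type) [Fintype ι] [DecidableEq ι] :
    (haarUnitary ι).IsMulRightInvariant := by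
  constructor
  intro g
  have : IsProbabilityMeasure ((haarUnitary ι).map (· * g)) :=
    Measure.isProbabilityMeasure_map (by fun_prop)
  exact Measure.isHaarMeasure_eq_of_isProbabilityMeasure _ _

section
variable {ι : Type} [Fintype ι] [DecidableEq ι]

/-- The vector `U|o⟩`. -/
def unitaryCol (o : ι) (U : Matrix.unitaryGroup ι ℂ) : ι → ℂ := fun x => (U : Matrix ι ι ℂ) x o

/-- The law of a Haar random unit vector. -/
noncomputable def haarVec (o : ι) : Measure (ι → ℂ) := (haarUnitary ι).map (unitaryCol o)

/-- The rank-one matrix `|ψ⟩⟨ψ|`. -/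
def pureState {ι : Type} (ψ : ι → ℂ) : Matrix ι ι ℂ := vecMulVec ψ (star ψ)

omit [Fintype ι] [DecidableEq ι] in
theorem pureState_apply (ψ : ι → ℂ) (x y : ι) : pureState ψ x y = ψ x * star (ψ y) := rfl

theorem continuous_unitaryCol (o : ι) : Continuous (unitaryCol o) := by
  unfold unitaryCol
  refine continuous_pi fun x => ?_
  exact (continuous_apply_apply x o).comp continuous_subtype_val

omit [Fintype ι] [DecidableEq ι] in
theorem continuous_pureState : Continuous (pureState : (ι → ℂ) → Matrix ι ι ℂ) := by
  unfold pureState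
  fun_prop

theorem pureState_unitaryCol (o : ι) (U : Matrix.unitaryGroup ι ℂ) :
    pureState (unitaryCol o U) =
      (U : Matrix ι ι ℂ) * Matrix.single o o (1 : ℂ) * (U : Matrix ι ι ℂ).conjTranspose := by
  ext x y
  simp [pureState_apply, unitaryCol, Matrix.mul_apply, Matrix.single_apply, Finset.sum_ite_eq,
    ite_and]

instance haarVec_isProbabilityMeasure (o : ι) : IsProbabilityMeasure (haarVec o) :=
  Measure.isProbabilityMeasure_map (continuous_unitaryCol o).measurable.aemeasurable

theorem haarPure_eq_map (o : ι) : haarPure o = (haarVec o).map pureState := by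
  unfold haarVec
  rw [Measure.map_map continuous_pureState.measurable (continuous_unitaryCol o).measurable]
  unfold haarPure
  congr 1
  funext U
  exact (pureState_unitaryCol o U).symm

theorem integral_haarPure (o : ι) {f : Matrix ι ι ℂ → ℝ} (hf : Continuous f) :
    ∫ ρ, f ρ ∂(haarPure o) = ∫ ψ, f (pureState ψ) ∂(haarVec o) := by
  rw [haarPure_eq_map]
  exact integral_map continuous_pureState.measurable.aemeasurable hf.aestronglyMeasurable

theorem sum_normSq_unitaryCol (o : ι) (U : Matrix.unitaryGroup ι ℂ) :
    ∑ x, ‖unitaryCol o U x‖ ^ 2 = 1 := by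
  have h := congrFun (congrFun (Matrix.mem_unitaryGroup_iff'.mp U.2) o) o
  simp only [Matrix.mul_apply, Matrix.star_apply, Matrix.one_apply_eq] at h
  have h2 : (((∑ x, ‖unitaryCol o U x‖ ^ 2 : ℝ)) : ℂ) = 1 := by
    rw [← h]
    push_cast
    refine Finset.sum_congr rfl fun x _ => ?_
    exact (Complex.conj_mul' _).symm
  exact_mod_cast h2

theorem ae_haarVec_sum_normSq (o : ι) : ∀ᵐ ψ ∂(haarVec o), ∑ x, ‖ψ x‖ ^ 2 = 1 := by
  unfold haarVec
  rw [ae_map_iff (continuous_unitaryCol o).measurable.aemeasurable]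
  · exact Filter.Eventually.of_forall fun U => sum_normSq_unitaryCol o U
  · exact (isClosed_eq (by fun_prop) continuous_const).measurableSet

/-- The law is pushed forward from a compact group, so continuous functions are integrable without
any growth condition. -/
theorem integrable_haarVec {E : Type*} [NormedAddCommGroup E] [SecondCountableTopology E]
    (o : ι) {f : (ι → ℂ) → E}
    (hf : Continuous f) : Integrable f (haarVec o) := by
  unfold haarVec
  borelize E
  rw [integrable_map_measure hf.aestronglyMeasurable
    (continuous_unitaryCol o).measurable.aemeasurable]
  exact (hf.comp (continuous_unitaryCol o)).integrable_of_hasCompactSupport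
    (HasCompactSupport.of_compactSpace _)

/-- Every unit vector is a column of a unitary matrix. -/
theorem exists_unitaryCol_eq (o : ι) (ψ : ι → ℂ) (hψ : ∑ x, ‖ψ x‖ ^ 2 = 1) :
    ∃ U : Matrix.unitaryGroup ι ℂ, unitaryCol o U = ψ := by
  have hn : ‖(WithLp.toLp 2 ψ : EuclideanSpace ℂ ι)‖ = 1 := by
    rw [EuclideanSpace.norm_eq]; simp [hψ]
  have hv : Orthonormal ℂ (({o} : Set ι).domRestrict fun _ : ι =>
      (WithLp.toLp 2 ψ : EuclideanSpace ℂ ι)) := by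
    constructor
    · intro i; exact hn
    · intro i j hij; exact absurd (Subsingleton.elim i j) hij
  obtain ⟨b, hb⟩ := hv.exists_orthonormalBasis_extension_of_card_eq (by simp)
  refine ⟨⟨Matrix.of fun x j => b j x, ?_⟩, ?_⟩
  · rw [Matrix.mem_unitaryGroup_iff']
    ext i j
    have := orthonormal_iff_ite.mp b.orthonormal i j
    rw [PiLp.inner_apply] at this
    simp only [Matrix.mul_apply, Matrix.star_apply, Matrix.of_apply, Matrix.one_apply, ← this]
    refine Finset.sum_congr rfl fun x _ => ?_
    simp [mul_comm]
  · funext x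
    simp [unitaryCol, hb o rfl]

/-- With ψ = V|o⟩ one has Uψ = UV|o⟩, and right invariance absorbs V. -/
theorem lintegral_unitary_mulVec (o : ι) {f : (ι → ℂ) → ℝ≥0∞} (hf : Measurable f) (ψ : ι → ℂ)
    (hψ : ∑ x, ‖ψ x‖ ^ 2 = 1) :
    ∫⁻ U : Matrix.unitaryGroup ι ℂ, f ((U : Matrix ι ι ℂ) *ᵥ ψ) ∂(haarUnitary ι)
      = ∫⁻ φ, f φ ∂(haarVec o) := by
  obtain ⟨V, rfl⟩ := exists_unitaryCol_eq o ψ hψ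
  unfold haarVec
  rw [lintegral_map hf (continuous_unitaryCol o).measurable]
  rw [← lintegral_mul_right_eq_self (fun U => f (unitaryCol o U)) V]
  rfl

end

/-! ### Complex Gaussian vectors -/

/-- The density of the standard complex Gaussian law. -/
noncomputable def gaussDensity (z : ℂ) : ℝ := Real.pi⁻¹ * Real.exp (-‖z‖ ^ 2)

theorem gaussDensity_nonneg (z : ℂ) : 0 ≤ gaussDensity z := by
  unfold gaussDensity; positivity

theorem continuous_gaussDensity : Continuous gaussDensity := by
  unfold gaussDensity; fun_prop

/-- The standard complex Gaussian law on `ℂ`. -/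
noncomputable def complexGauss : Measure ℂ :=
  volume.withDensity fun z => ENNReal.ofReal (gaussDensity z)

theorem integral_norm_pow_mul_gaussDensity (q : ℕ) :
    ∫ z : ℂ, ‖z‖ ^ q * gaussDensity z = Real.Gamma (q / 2 + 1) := by
  have h := Complex.integral_rpow_mul_exp_neg_rpow (p := 2) (q := q) (by norm_num)
    (by linarith [Nat.cast_nonneg (α := ℝ) q])
  simp only [Real.rpow_natCast, Real.rpow_two] at h
  have h2 : (fun z : ℂ => ‖z‖ ^ q * gaussDensity z)
      = fun z : ℂ => Real.pi⁻¹ * (‖z‖ ^ q * Real.exp (-‖z‖ ^ 2)) := by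
    funext z; unfold gaussDensity; ring
  rw [h2, integral_const_mul, h, show ((q : ℝ) + 2) / 2 = q / 2 + 1 by ring]
  field_simp

/-- The Bochner integral of a nonintegrable function is `0` by convention, whereas the computed
Gamma value is positive. -/
theorem integrable_norm_pow_mul_gaussDensity (q : ℕ) :
    Integrable fun z : ℂ => ‖z‖ ^ q * gaussDensity z := by
  by_contra h
  have h1 := integral_undef h
  rw [integral_norm_pow_mul_gaussDensity] at h1
  exact (Real.Gamma_pos_of_pos (by positivity)).ne' h1

theorem integral_complexGauss {E : Type*} [NormedAddCommGroup E] [NormedSpace ℝ E] (f : ℂ → E) :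
    ∫ z, f z ∂complexGauss = ∫ z, gaussDensity z • f z := by
  unfold complexGauss
  rw [integral_withDensity_eq_integral_toReal_smul
    (continuous_gaussDensity.measurable.ennreal_ofReal) (by simp)]
  simp [ENNReal.toReal_ofReal, gaussDensity_nonneg]

instance complexGauss_isProbabilityMeasure : IsProbabilityMeasure complexGauss := by
  constructor
  unfold complexGauss
  rw [withDensity_apply _ MeasurableSet.univ, Measure.restrict_univ,
    ← ofReal_integral_eq_lintegral_ofReal]
  · have := integral_norm_pow_mul_gaussDensity 0
    simp at this
    simp [this]
  · simpa using integrable_norm_pow_mul_gaussDensity 0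
  · exact Filter.Eventually.of_forall gaussDensity_nonneg

theorem integrable_complexGauss {E : Type*} [NormedAddCommGroup E] [NormedSpace ℝ E]
    [SecondCountableTopology E] {f : ℂ → E}
    (hf : Continuous f) (q : ℕ) (hq : ∀ z, ‖f z‖ ≤ ‖z‖ ^ q) : Integrable f complexGauss := by
  borelize E
  unfold complexGauss
  rw [integrable_withDensity_iff_integrable_smul'
    (continuous_gaussDensity.measurable.ennreal_ofReal) (by simp)]
  refine (integrable_norm_pow_mul_gaussDensity q).mono'
    (by
      simp only [ENNReal.toReal_ofReal (gaussDensity_nonneg _)]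
      exact (continuous_gaussDensity.smul hf).aestronglyMeasurable) ?_
  refine Filter.Eventually.of_forall fun z => ?_
  rw [ENNReal.toReal_ofReal (gaussDensity_nonneg _), norm_smul, Real.norm_eq_abs,
    abs_of_nonneg (gaussDensity_nonneg _), mul_comm]
  exact mul_le_mul_of_nonneg_right (hq z) (gaussDensity_nonneg z)

theorem integral_complexGauss_normSq_pow (k : ℕ) :
    ∫ z, (‖z‖ ^ 2) ^ k ∂complexGauss = k.factorial := by
  rw [integral_complexGauss]
  simp only [smul_eq_mul, mul_comm (gaussDensity _), ← pow_mul]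
  rw [integral_norm_pow_mul_gaussDensity, ← Real.Gamma_nat_eq_factorial]
  congr 1
  push_cast; ring

theorem integrable_conj_pow_mul_pow (j k : ℕ) :
    Integrable (fun z : ℂ => (starRingEnd ℂ z) ^ j * z ^ k) complexGauss :=
  integrable_complexGauss (by fun_prop) (j + k) fun z => by simp [pow_add]

theorem integral_conj_pow_mul_pow (j k : ℕ) :
    ∫ z : ℂ, (starRingEnd ℂ z) ^ j * z ^ k ∂complexGauss = if j = k then (k.factorial : ℂ) else 0 := by
  split_ifs with h
  · subst h
    rw [← Complex.ofReal_natCast, ← integral_complexGauss_normSq_pow j, ← integral_complex_ofReal]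
    refine integral_congr_ae (Filter.Eventually.of_forall fun z => ?_)
    simp only
    rw [← mul_pow, Complex.conj_mul']
    push_cast; rfl
  · rw [integral_complexGauss]
    -- Rotation by the angle π/(k-j) fixes the density and multiplies the monomial by exp(iπ) = -1,
    -- so the integral equals its negative.
    set u : Circle := Circle.exp (Real.pi / ((k : ℝ) - j)) with hu
    have hkj : (k : ℝ) - j ≠ 0 := sub_ne_zero.mpr (by exact_mod_cast Ne.symm h)
    have hmp : MeasurePreserving (rotation u : ℂ → ℂ) volume volume :=
      (rotation u).measurePreserving
    have h1 := hmp.integral_comp (rotation u).toHomeomorph.measurableEmbedding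
      (fun z : ℂ => gaussDensity z • ((starRingEnd ℂ z) ^ j * z ^ k))
    have h2 : ∀ z : ℂ, gaussDensity (rotation u z) •
        ((starRingEnd ℂ (rotation u z)) ^ j * (rotation u z) ^ k)
        = -(gaussDensity z • ((starRingEnd ℂ z) ^ j * z ^ k)) := by
      intro z
      have h3 : gaussDensity (rotation u z) = gaussDensity z := by
        simp [gaussDensity, Circle.norm_coe u]
      have h4 : (starRingEnd ℂ (u : ℂ)) ^ j * (u : ℂ) ^ k = -1 := by
        rw [hu, Circle.coe_exp, ← Complex.exp_conj, ← Complex.exp_nat_mul, ← Complex.exp_nat_mul,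
          ← Complex.exp_add, ← Complex.exp_pi_mul_I]
        congr 1
        have : (k : ℂ) - j ≠ 0 := by exact_mod_cast hkj
        simp only [map_mul, Complex.conj_ofReal, Complex.conj_I]
        push_cast
        field_simp
        ring
      rw [h3, rotation_apply, map_mul, mul_pow, mul_pow]
      calc gaussDensity z • ((starRingEnd ℂ (u : ℂ)) ^ j * (starRingEnd ℂ z) ^ j *
            ((u : ℂ) ^ k * z ^ k))
          = gaussDensity z • (((starRingEnd ℂ (u : ℂ)) ^ j * (u : ℂ) ^ k) *
            ((starRingEnd ℂ z) ^ j * z ^ k)) := by congr 1; ring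
        _ = _ := by rw [h4]; simp
    simp only [h2, integral_neg] at h1
    exact self_eq_neg.mp h1.symm

section
variable {ι : Type} [Fintype ι]

/-- The standard complex Gaussian law on `ℂ^ι`. -/
noncomputable def gaussVec (ι : Type) [Fintype ι] : Measure (ι → ℂ) :=
  Measure.pi fun _ => complexGauss

instance gaussVec_isProbabilityMeasure : IsProbabilityMeasure (gaussVec ι) := by
  unfold gaussVec; infer_instance

/-- The joint density depends on the vector only through its norm, which gives unitary invariance.
-/
theorem gaussVec_eq_withDensity :
    gaussVec ι = volume.withDensity fun z => ENNReal.ofReal (∏ i, gaussDensity (z i)) := by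
  unfold gaussVec
  refine Measure.pi_eq fun s hs => ?_
  have hint : ∀ i, IntegrableOn gaussDensity (s i) := fun i => by
    have := integrable_norm_pow_mul_gaussDensity 0
    simp only [pow_zero, one_mul] at this
    exact this.integrableOn
  rw [withDensity_apply _ (MeasurableSet.univ_pi hs), volume_pi, Measure.restrict_pi_pi,
    ← ofReal_integral_eq_lintegral_ofReal]
  · rw [integral_fintype_prod_eq_prod (fun _ => gaussDensity), ENNReal.ofReal_prod_of_nonneg]
    · refine Finset.prod_congr rfl fun i _ => ?_
      unfold complexGauss
      rw [withDensity_apply _ (hs i), ← ofReal_integral_eq_lintegral_ofReal (hint i)]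
      exact Filter.Eventually.of_forall gaussDensity_nonneg
    · exact fun i _ => integral_nonneg gaussDensity_nonneg
  · exact Integrable.fintype_prod (f := fun _ => gaussDensity) hint
  · exact Filter.Eventually.of_forall fun z => Finset.prod_nonneg fun i _ => gaussDensity_nonneg _

theorem prod_gaussDensity (z : ι → ℂ) :
    ∏ i, gaussDensity (z i) = (Real.pi⁻¹) ^ Fintype.card ι * Real.exp (-∑ i, ‖z i‖ ^ 2) := by
  simp [gaussDensity, Finset.prod_mul_distrib, ← Real.exp_sum]

theorem sum_normSq_mulVec [DecidableEq ι] (U : Matrix.unitaryGroup ι ℂ) (z : ι → ℂ) :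
    ∑ i, ‖((U : Matrix ι ι ℂ) *ᵥ z) i‖ ^ 2 = ∑ i, ‖z i‖ ^ 2 := by
  have key : ∀ w : ι → ℂ, ((∑ i, ‖w i‖ ^ 2 : ℝ) : ℂ) = star w ⬝ᵥ w := by
    intro w
    push_cast
    simp only [dotProduct, Pi.star_apply]
    exact Finset.sum_congr rfl fun x _ => (Complex.conj_mul' _).symm
  have : ((∑ i, ‖((U : Matrix ι ι ℂ) *ᵥ z) i‖ ^ 2 : ℝ) : ℂ) = ((∑ i, ‖z i‖ ^ 2 : ℝ) : ℂ) := by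
    rw [key, key, star_mulVec, ← dotProduct_mulVec, mulVec_mulVec]
    have : (U : Matrix ι ι ℂ)ᴴ * (U : Matrix ι ι ℂ) = 1 := Matrix.mem_unitaryGroup_iff'.mp U.2
    rw [this, one_mulVec]
  exact_mod_cast this

theorem measurePreserving_mulVec_volume [DecidableEq ι] (U : Matrix.unitaryGroup ι ℂ) :
    MeasurePreserving (fun z : ι → ℂ => (U : Matrix ι ι ℂ) *ᵥ z) volume volume := by
  refine ⟨by fun_prop, ?_⟩
  have hnorm : ‖(U : Matrix ι ι ℂ).det‖ = 1 := by
    have := Matrix.det_of_mem_unitary U.2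
    exact CStarRing.norm_of_mem_unitary this
  -- The real determinant of a complex linear map is the squared modulus of its complex determinant.
  have hdet : |LinearMap.det ((Matrix.toLin' (U : Matrix ι ι ℂ)).restrictScalars ℝ)| = 1 := by
    rw [LinearMap.det_restrictScalars, LinearMap.det_toLin', Algebra.norm_complex_apply,
      Complex.normSq_eq_norm_sq, hnorm]
    norm_num
  have h := Measure.map_linearMap_addHaar_eq_smul_addHaar (volume : Measure (ι → ℂ))
    (f := (Matrix.toLin' (U : Matrix ι ι ℂ)).restrictScalars ℝ)
    (by intro h0; rw [h0] at hdet; simp at hdet)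
  rw [abs_inv, hdet, inv_one, ENNReal.ofReal_one, one_smul] at h
  exact h

theorem measurePreserving_mulVec_gaussVec [DecidableEq ι] (U : Matrix.unitaryGroup ι ℂ) :
    MeasurePreserving (fun z : ι → ℂ => (U : Matrix ι ι ℂ) *ᵥ z) (gaussVec ι) (gaussVec ι) := by
  refine ⟨by fun_prop, ?_⟩
  refine Measure.ext_of_lintegral _ fun f hf => ?_
  have hm : Measurable fun z : ι → ℂ => ENNReal.ofReal (∏ i, gaussDensity (z i)) := by
    have := continuous_gaussDensity.measurable
    fun_prop
  rw [lintegral_map hf (by fun_prop), gaussVec_eq_withDensity,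
    lintegral_withDensity_eq_lintegral_mul _ hm (by fun_prop),
    lintegral_withDensity_eq_lintegral_mul _ hm hf,
    ← (measurePreserving_mulVec_volume U).lintegral_comp (hm.mul hf)]
  refine lintegral_congr fun z => ?_
  simp only [Pi.mul_apply, prod_gaussDensity, sum_normSq_mulVec]

theorem gaussVec_absolutelyContinuous : gaussVec ι ≪ volume := by
  rw [gaussVec_eq_withDensity]
  exact withDensity_absolutelyContinuous _ _

end

/-! ### Moments of Gaussian vectors and passage to the unit sphere -/

section
variable {ι : Type} [Fintype ι]

theorem integrable_gaussVec_monomial (a b : ι → ℕ) :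
    Integrable (fun z : ι → ℂ => ∏ i, ((starRingEnd ℂ (z i)) ^ a i * z i ^ b i)) (gaussVec ι) :=
  Integrable.fintype_prod (f := fun i z => (starRingEnd ℂ z) ^ a i * z ^ b i)
    fun i => integrable_conj_pow_mul_pow (a i) (b i)

theorem integral_gaussVec_monomial (a b : ι → ℕ) :
    ∫ z : ι → ℂ, ∏ i, ((starRingEnd ℂ (z i)) ^ a i * z i ^ b i) ∂(gaussVec ι)
      = if a = b then ∏ i, ((b i).factorial : ℂ) else 0 := by
  unfold gaussVec
  rw [integral_fintype_prod_eq_prod (fun i z => (starRingEnd ℂ z) ^ a i * z ^ b i)]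
  simp only [integral_conj_pow_mul_pow]
  split_ifs with h
  · subst h; simp
  · obtain ⟨i, hi⟩ := Function.ne_iff.mp h
    exact Finset.prod_eq_zero (Finset.mem_univ i) (by simp [hi])

theorem integrable_gaussVec_normSq_pow (a : ι → ℕ) :
    Integrable (fun z : ι → ℂ => ∏ i, (‖z i‖ ^ 2) ^ a i) (gaussVec ι) :=
  Integrable.fintype_prod (f := fun i z => (‖z‖ ^ 2) ^ a i)
    fun i => integrable_complexGauss (by fun_prop) (2 * a i) fun z => by
      simp [pow_mul]

theorem integral_gaussVec_normSq_pow (a : ι → ℕ) :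
    ∫ z : ι → ℂ, ∏ i, (‖z i‖ ^ 2) ^ a i ∂(gaussVec ι) = ∏ i, ((a i).factorial : ℝ) := by
  unfold gaussVec
  rw [integral_fintype_prod_eq_prod (fun i z => (‖z‖ ^ 2) ^ a i)]
  simp only [integral_complexGauss_normSq_pow]

/-- The free exponent `a` makes the induction close: one factor of the squared norm splits into the
sum over `j` of raising `a j` by one, each term gains the factor `a j + 1`, and these factors add up
to `card ι + ∑ a`. -/
theorem gaussVec_norm_moment [DecidableEq ι] (T : ℕ) (a : ι → ℕ) :
    Integrable (fun z : ι → ℂ => (∑ i, ‖z i‖ ^ 2) ^ T * ∏ i, (‖z i‖ ^ 2) ^ a i) (gaussVec ι) ∧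
    ∫ z : ι → ℂ, (∑ i, ‖z i‖ ^ 2) ^ T * ∏ i, (‖z i‖ ^ 2) ^ a i ∂(gaussVec ι)
      = (∏ i, ((a i).factorial : ℝ)) * ((Fintype.card ι + ∑ i, a i).ascFactorial T : ℕ) := by
  induction T generalizing a with
  | zero => simp [integral_gaussVec_normSq_pow, integrable_gaussVec_normSq_pow]
  | succ T ih =>
    have hsplit : ∀ z : ι → ℂ, (∑ i, ‖z i‖ ^ 2) ^ (T + 1) * ∏ i, (‖z i‖ ^ 2) ^ a i
        = ∑ j, (∑ i, ‖z i‖ ^ 2) ^ T * ∏ i, (‖z i‖ ^ 2) ^ ((a + Pi.single j 1 : ι → ℕ) i) := by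
      intro z
      rw [pow_succ, mul_assoc, Finset.sum_mul, Finset.mul_sum]
      refine Finset.sum_congr rfl fun j _ => ?_
      congr 1
      simp only [Pi.add_apply, pow_add, Finset.prod_mul_distrib]
      rw [mul_comm]
      congr 1
      rw [Finset.prod_eq_single j]
      · simp
      · intro b _ hb; simp [hb]
      · simp
    simp only [hsplit]
    refine ⟨integrable_finsetSum _ fun j _ => (ih _).1, ?_⟩
    rw [integral_finsetSum _ fun j _ => (ih _).1]
    simp only [(ih _).2]
    have hfac : ∀ j, ∏ i, (((a + Pi.single j 1 : ι → ℕ) i).factorial : ℝ)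
        = (a j + 1) * ∏ i, ((a i).factorial : ℝ) := by
      intro j
      rw [← Finset.mul_prod_erase Finset.univ _ (Finset.mem_univ j),
        ← Finset.mul_prod_erase Finset.univ (fun i => ((a i).factorial : ℝ)) (Finset.mem_univ j),
        ← mul_assoc]
      congr 1
      · simp [Nat.factorial_succ]
      · refine Finset.prod_congr rfl fun i hi => ?_
        simp [Finset.ne_of_mem_erase hi]
    have hsum : ∀ j, ∑ i, (a + Pi.single j 1 : ι → ℕ) i = (∑ i, a i) + 1 := by
      intro j; simp [Finset.sum_add_distrib]
    simp only [hfac, hsum]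
    have hasc := Nat.succ_ascFactorial (Fintype.card ι + ∑ i, a i) T
    rw [← Finset.sum_mul, ← Finset.sum_mul, Finset.sum_add_distrib, Nat.ascFactorial_succ, ← hasc,
      ← add_assoc]
    push_cast
    simp only [Finset.sum_const, Finset.card_univ, nsmul_eq_mul, mul_one]
    ring

variable [DecidableEq ι]

/-- Averaging a homogeneous function over a Gaussian vector and over a Haar random unit vector. -/
theorem lintegral_gaussVec_of_homogeneous (o : ι) (T : ℕ) {f : (ι → ℂ) → ℝ≥0∞}
    (hf : Measurable f)
    (hom : ∀ (c : ℝ) (z : ι → ℂ), 0 < c → f ((c : ℂ) • z) = ENNReal.ofReal (c ^ 2) ^ T * f z) :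
    ∫⁻ z, f z ∂(gaussVec ι)
      = ((Fintype.card ι).ascFactorial T : ℕ) * ∫⁻ ψ, f ψ ∂(haarVec o) := by
  have h1 : ∀ U : Matrix.unitaryGroup ι ℂ,
      ∫⁻ z, f ((U : Matrix ι ι ℂ) *ᵥ z) ∂(gaussVec ι) = ∫⁻ z, f z ∂(gaussVec ι) := fun U =>
    (measurePreserving_mulVec_gaussVec U).lintegral_comp hf
  -- Every U preserves the Gaussian law, so a Haar average over U can be inserted and the integrals
  -- swapped. For fixed z ≠ 0 the inner average is |z|^(2T) times the Haar mean of `f`, and E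
  -- |z|^(2T) is the ascending factorial.
  have h2 : ∫⁻ z, f z ∂(gaussVec ι) = ∫⁻ U : Matrix.unitaryGroup ι ℂ,
      ∫⁻ z, f ((U : Matrix ι ι ℂ) *ᵥ z) ∂(gaussVec ι) ∂(haarUnitary ι) := by
    simp [h1]
  have hcont : Continuous fun p : Matrix.unitaryGroup ι ℂ × (ι → ℂ) =>
      (p.1 : Matrix ι ι ℂ) *ᵥ p.2 := by fun_prop
  rw [h2, lintegral_lintegral_swap
    (f := fun (U : Matrix.unitaryGroup ι ℂ) z => f ((U : Matrix ι ι ℂ) *ᵥ z))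
    (hf.comp hcont.measurable).aemeasurable]
  have : Nonempty ι := ⟨o⟩
  have hne : ∀ᵐ z ∂(gaussVec ι), z ≠ 0 :=
    gaussVec_absolutelyContinuous.ae_le (compl_mem_ae_iff.mpr (measure_singleton _))
  have h3 : ∀ᵐ z ∂(gaussVec ι), ∫⁻ U : Matrix.unitaryGroup ι ℂ,
      f ((U : Matrix ι ι ℂ) *ᵥ z) ∂(haarUnitary ι)
      = ENNReal.ofReal ((∑ i, ‖z i‖ ^ 2) ^ T) * ∫⁻ ψ, f ψ ∂(haarVec o) := by
    filter_upwards [hne] with z hz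
    have hpos : 0 < ∑ i, ‖z i‖ ^ 2 := by
      obtain ⟨i, hi⟩ := Function.ne_iff.mp hz
      exact Finset.sum_pos' (fun _ _ => by positivity) ⟨i, Finset.mem_univ _, by
        have := norm_pos_iff.mpr hi; positivity⟩
    set r := Real.sqrt (∑ i, ‖z i‖ ^ 2) with hr
    have hrpos : 0 < r := Real.sqrt_pos.mpr hpos
    have hr2 : r ^ 2 = ∑ i, ‖z i‖ ^ 2 := Real.sq_sqrt hpos.le
    set w : ι → ℂ := ((r⁻¹ : ℝ) : ℂ) • z with hw
    have hzw : z = (r : ℂ) • w := by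
      rw [hw, smul_smul, ← Complex.ofReal_mul, mul_inv_cancel₀ hrpos.ne']; simp
    have hwn : ∑ i, ‖w i‖ ^ 2 = 1 := by
      simp only [hw, Pi.smul_apply, norm_smul, mul_pow, ← Finset.mul_sum, Complex.norm_real, ← hr2]
      simp [hrpos.ne']
    rw [← hr2]
    conv_lhs => rw [hzw]
    simp only [mulVec_smul, hom r _ hrpos]
    rw [lintegral_const_mul' _ _ (by simp), lintegral_unitary_mulVec o hf w hwn,
      ENNReal.ofReal_pow (sq_nonneg r)]
  rw [lintegral_congr_ae h3, lintegral_mul_const _ (by fun_prop)]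
  congr 1
  have hm := gaussVec_norm_moment (ι := ι) T 0
  simp only [Pi.zero_apply, pow_zero, Finset.prod_const_one, mul_one, Nat.factorial_zero,
    Nat.cast_one, one_mul, Finset.sum_const_zero, add_zero] at hm
  rw [← ofReal_integral_eq_lintegral_ofReal hm.1
    (Filter.Eventually.of_forall fun z => by positivity), hm.2]
  simp

theorem integral_gaussVec_of_homogeneous (o : ι) (T : ℕ) {f : (ι → ℂ) → ℝ}
    (hf : Continuous f) (h0 : ∀ z, 0 ≤ f z)
    (hom : ∀ (c : ℝ) (z : ι → ℂ), 0 < c → f ((c : ℂ) • z) = (c ^ 2) ^ T * f z) :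
    ∫ z, f z ∂(gaussVec ι)
      = ((Fintype.card ι).ascFactorial T : ℕ) * ∫ ψ, f ψ ∂(haarVec o) := by
  rw [integral_eq_lintegral_of_nonneg_ae (Filter.Eventually.of_forall h0) hf.aestronglyMeasurable,
    integral_eq_lintegral_of_nonneg_ae (Filter.Eventually.of_forall h0) hf.aestronglyMeasurable,
    lintegral_gaussVec_of_homogeneous o T hf.measurable.ennreal_ofReal]
  · rw [ENNReal.toReal_mul]; simp
  · intro c z hc
    rw [hom c z hc, ENNReal.ofReal_mul (by positivity), ENNReal.ofReal_pow (by positivity)]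

theorem integral_haarVec_normSq_pow (o : ι) (a : ι → ℕ) :
    ∫ ψ, ∏ i, (‖ψ i‖ ^ 2) ^ a i ∂(haarVec o)
      = (∏ i, ((a i).factorial : ℝ)) / ((Fintype.card ι).ascFactorial (∑ i, a i) : ℕ) := by
  have h := integral_gaussVec_of_homogeneous o (∑ i, a i)
    (f := fun z : ι → ℂ => ∏ i, (‖z i‖ ^ 2) ^ a i) (by fun_prop) (fun z => by positivity)
    (fun c z hc => by
      simp only [Pi.smul_apply, norm_smul, mul_pow, Finset.prod_mul_distrib, Complex.norm_real,
        Real.norm_eq_abs, sq_abs]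
      rw [← Finset.prod_pow_eq_pow_sum])
  rw [integral_gaussVec_normSq_pow] at h
  have : Nonempty ι := ⟨o⟩
  have hpos : 0 < ((Fintype.card ι).ascFactorial (∑ i, a i) : ℝ) := by
    have : 0 < Fintype.card ι := Fintype.card_pos
    obtain ⟨m, hm⟩ := Nat.exists_eq_succ_of_ne_zero this.ne'
    rw [hm]; exact_mod_cast Nat.ascFactorial_pos _ _
  rw [h]; field_simp

end

/-! ### Fock space norms of polynomials -/

section
variable {ι : Type} [Fintype ι]

/-- The squared norm of a polynomial in Fock space. -/
noncomputable def fockNormSq (P : MvPolynomial ι ℂ) : ℝ :=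
  ∫ z, ‖MvPolynomial.eval z P‖ ^ 2 ∂(gaussVec ι)

theorem conj_eval_mul_eval (P : MvPolynomial ι ℂ) (z : ι → ℂ) :
    ((‖MvPolynomial.eval z P‖ ^ 2 : ℝ) : ℂ) = ∑ a ∈ P.support, ∑ b ∈ P.support,
      (starRingEnd ℂ (P.coeff a) * P.coeff b) *
        ∏ i, ((starRingEnd ℂ (z i)) ^ a i * z i ^ b i) := by
  push_cast
  rw [← Complex.conj_mul', MvPolynomial.eval_eq', map_sum, Finset.sum_mul_sum]
  refine Finset.sum_congr rfl fun a _ => Finset.sum_congr rfl fun b _ => ?_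
  simp only [map_mul, map_prod, map_pow, Finset.prod_mul_distrib]
  ring

theorem integrable_normSq_eval (P : MvPolynomial ι ℂ) :
    Integrable (fun z => ‖MvPolynomial.eval z P‖ ^ 2) (gaussVec ι) := by
  have h : Integrable (fun z => ((‖MvPolynomial.eval z P‖ ^ 2 : ℝ) : ℂ)) (gaussVec ι) := by
    simp only [conj_eval_mul_eval]
    exact integrable_finsetSum _ fun a _ => integrable_finsetSum _ fun b _ =>
      (integrable_gaussVec_monomial a b).const_mul _
  exact h.re

/-- Monomials are orthogonal under the Gaussian law, with squared norms given by products of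
factorials. -/
theorem fockNormSq_eq_sum (P : MvPolynomial ι ℂ) :
    fockNormSq P = ∑ a ∈ P.support, ‖P.coeff a‖ ^ 2 * ∏ i, ((a i).factorial : ℝ) := by
  have h : ((fockNormSq P : ℝ) : ℂ) = ((∑ a ∈ P.support,
      ‖P.coeff a‖ ^ 2 * ∏ i, ((a i).factorial : ℝ) : ℝ) : ℂ) := by
    unfold fockNormSq
    rw [← integral_complex_ofReal]
    simp only [conj_eval_mul_eval]
    have hI : ∀ a b : ι →₀ ℕ, Integrable (fun z : ι → ℂ =>
        (starRingEnd ℂ (P.coeff a) * P.coeff b) *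
          ∏ i, ((starRingEnd ℂ (z i)) ^ a i * z i ^ b i)) (gaussVec ι) :=
      fun a b => (integrable_gaussVec_monomial a b).const_mul _
    rw [integral_finsetSum _ fun a _ => integrable_finsetSum _ fun b _ => hI a b]
    push_cast
    refine Finset.sum_congr rfl fun a ha => ?_
    rw [integral_finsetSum _ fun b _ => hI a b]
    simp only [integral_const_mul, integral_gaussVec_monomial, DFunLike.coe_fn_eq, mul_ite, mul_zero]
    rw [Finset.sum_ite_eq, if_pos ha, Complex.conj_mul']
  exact_mod_cast h

theorem fockNormSq_nonneg (P : MvPolynomial ι ℂ) : 0 ≤ fockNormSq P :=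
  integral_nonneg fun _ => by positivity

/-- Multiplication by a variable shifts exponents injectively, and the factorial weights can only
grow. -/
theorem fockNormSq_le_X_mul [DecidableEq ι] (o : ι) (P : MvPolynomial ι ℂ) :
    fockNormSq P ≤ fockNormSq (MvPolynomial.X o * P) := by
  rw [fockNormSq_eq_sum, fockNormSq_eq_sum, MvPolynomial.support_X_mul, Finset.sum_map]
  refine Finset.sum_le_sum fun a _ => ?_
  simp only [addLeftEmbedding_apply, MvPolynomial.coeff_X_mul]
  refine mul_le_mul_of_nonneg_left ?_ (by positivity)
  refine Finset.prod_le_prod (fun i _ => by positivity) fun i _ => ?_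
  exact_mod_cast Nat.factorial_le (by simp)

/-- The linear form `z ↦ ∑ i, v i * z i`. -/
noncomputable def linForm (v : ι → ℂ) : MvPolynomial ι ℂ :=
  ∑ i, MvPolynomial.C (v i) * MvPolynomial.X i

theorem eval_linForm (v z : ι → ℂ) : MvPolynomial.eval z (linForm v) = v ⬝ᵥ z := by
  simp [linForm, dotProduct]

theorem fockNormSq_comp_unitary [DecidableEq ι] (U : Matrix.unitaryGroup ι ℂ)
    (P : MvPolynomial ι ℂ) :
    fockNormSq (MvPolynomial.bind₁ (fun i => linForm fun j => (U : Matrix ι ι ℂ) i j) P)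
      = fockNormSq P := by
  have h : ∀ z, MvPolynomial.eval z
      (MvPolynomial.bind₁ (fun i => linForm fun j => (U : Matrix ι ι ℂ) i j) P)
      = MvPolynomial.eval ((U : Matrix ι ι ℂ) *ᵥ z) P := by
    intro z
    rw [← MvPolynomial.coe_aeval_eq_eval, ← MvPolynomial.coe_aeval_eq_eval, RingHom.coe_coe,
      RingHom.coe_coe, MvPolynomial.aeval_bind₁]
    congr 2
    funext i
    rw [← RingHom.coe_coe, MvPolynomial.coe_aeval_eq_eval, eval_linForm]
    rfl
  unfold fockNormSq
  simp only [h]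
  have hc : Continuous fun z : ι → ℂ => ‖MvPolynomial.eval z P‖ ^ 2 :=
    (MvPolynomial.continuous_eval P).norm.pow 2
  have hm := measurePreserving_mulVec_gaussVec U
  rw [← integral_map (f := fun z : ι → ℂ => ‖MvPolynomial.eval z P‖ ^ 2) hm.measurable.aemeasurable
    hc.aestronglyMeasurable, hm.map_eq]

/-- A unitary change of variables turns the form v·z into |v| times a single variable, which reduces
the claim to `fockNormSq_le_X_mul`. -/
theorem fockNormSq_linForm_mul [DecidableEq ι] (v : ι → ℂ) (P : MvPolynomial ι ℂ) :
    (∑ i, ‖v i‖ ^ 2) * fockNormSq P ≤ fockNormSq (linForm v * P) := by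
  by_cases hv : ∑ i, ‖v i‖ ^ 2 = 0
  · rw [hv, zero_mul]; exact fockNormSq_nonneg _
  have hpos : 0 < ∑ i, ‖v i‖ ^ 2 := lt_of_le_of_ne (by positivity) (Ne.symm hv)
  obtain ⟨o⟩ : Nonempty ι := by
    by_contra h
    rw [not_nonempty_iff] at h
    simp at hv
  set r := Real.sqrt (∑ i, ‖v i‖ ^ 2) with hr
  have hrpos : 0 < r := Real.sqrt_pos.mpr hpos
  have hr2 : r ^ 2 = ∑ i, ‖v i‖ ^ 2 := Real.sq_sqrt hpos.le
  -- Column `o` of W is the conjugate of v/|v|; by unitarity the other columns give zero against v.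
  obtain ⟨W, hW⟩ := exists_unitaryCol_eq o (((r⁻¹ : ℝ) : ℂ) • star v) (by
    simp only [Pi.smul_apply, norm_smul, mul_pow, ← Finset.mul_sum, Complex.norm_real,
      Pi.star_apply, norm_star, ← hr2]
    simp [hrpos.ne'])
  set Q := MvPolynomial.bind₁ (fun i => linForm fun j => (W : Matrix ι ι ℂ) i j) P with hQ
  have hv' : v ᵥ* (W : Matrix ι ι ℂ) = Pi.single o (r : ℂ) := by
    have h1 : v = (r : ℂ) • star (unitaryCol o W) := by
      rw [hW]
      funext i
      simp [hrpos.ne']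
    have h2 : v = (r : ℂ) • (Pi.single o 1 ᵥ* (W : Matrix ι ι ℂ)ᴴ) := by
      rw [h1]
      funext i
      simp [unitaryCol]
    have hWW : (W : Matrix ι ι ℂ)ᴴ * (W : Matrix ι ι ℂ) = 1 := Matrix.mem_unitaryGroup_iff'.mp W.2
    rw [h2, smul_vecMul, vecMul_vecMul, hWW, vecMul_one]
    funext i
    by_cases hi : i = o
    · subst hi; simp
    · simp [hi]
  have hcomp : MvPolynomial.bind₁ (fun i => linForm fun j => (W : Matrix ι ι ℂ) i j) (linForm v * P)
      = MvPolynomial.C (r : ℂ) * (MvPolynomial.X o * Q) := by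
    rw [map_mul, ← mul_assoc]
    congr 1
    refine MvPolynomial.funext fun z => ?_
    have h1 : MvPolynomial.eval z (MvPolynomial.bind₁ (fun i => linForm fun j => (W : Matrix ι ι ℂ) i j)
        (linForm v)) = v ⬝ᵥ ((W : Matrix ι ι ℂ) *ᵥ z) := by
      simp only [linForm, map_sum, map_mul, MvPolynomial.bind₁_X_right, MvPolynomial.bind₁_C_right,
        MvPolynomial.eval_C, MvPolynomial.eval_X]
      rfl
    rw [h1, dotProduct_mulVec, hv']
    simp
  have hC : fockNormSq (MvPolynomial.C (r : ℂ) * (MvPolynomial.X o * Q))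
      = r ^ 2 * fockNormSq (MvPolynomial.X o * Q) := by
    unfold fockNormSq
    rw [← integral_const_mul]
    refine integral_congr_ae (Filter.Eventually.of_forall fun z => ?_)
    simp [mul_pow]
  rw [← fockNormSq_comp_unitary W (linForm v * P), hcomp, hC, hr2, ← fockNormSq_comp_unitary W P]
  exact mul_le_mul_of_nonneg_left (fockNormSq_le_X_mul o _) hpos.le

end

/-! ### Born probabilities of pure states and their correlation inequality -/

section
variable {ι : Type} [Fintype ι]

/-- The Born weight `⟨ψ|M|ψ⟩`. -/
noncomputable def born (M : Matrix ι ι ℂ) (ψ : ι → ℂ) : ℝ := ((M * pureState ψ).trace).re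

theorem trace_mul_pureState (M : Matrix ι ι ℂ) (ψ : ι → ℂ) :
    (M * pureState ψ).trace = star ψ ⬝ᵥ (M *ᵥ ψ) := by
  rw [pureState, mul_vecMulVec, trace_vecMulVec, dotProduct_comm]

theorem born_eq (M : Matrix ι ι ℂ) (ψ : ι → ℂ) : born M ψ = (star ψ ⬝ᵥ (M *ᵥ ψ)).re := by
  rw [born, trace_mul_pureState]

theorem continuous_born (M : Matrix ι ι ℂ) : Continuous (born M) := by
  have : born M = fun ψ => (star ψ ⬝ᵥ (M *ᵥ ψ)).re := funext (born_eq M)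
  rw [this]
  fun_prop

theorem born_nonneg {M : Matrix ι ι ℂ} (hM : M.PosSemidef) (ψ : ι → ℂ) : 0 ≤ born M ψ := by
  rw [born_eq]
  exact (Complex.nonneg_iff.mp (hM.dotProduct_mulVec_nonneg ψ)).1

theorem born_smul (M : Matrix ι ι ℂ) (c : ℝ) (ψ : ι → ℂ) :
    born M ((c : ℂ) • ψ) = c ^ 2 * born M ψ := by
  rw [born_eq, born_eq, mulVec_smul, star_smul, smul_dotProduct, dotProduct_smul, smul_smul]
  have : star (c : ℂ) * (c : ℂ) = ((c ^ 2 : ℝ) : ℂ) := by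
    rw [Complex.star_def, Complex.conj_ofReal]; push_cast; ring
  rw [this, smul_eq_mul, Complex.re_ofReal_mul]

theorem born_mulVec {κ : Type} [Fintype κ] (M : Matrix ι ι ℂ) (V : Matrix ι κ ℂ) (ψ : κ → ℂ) :
    born M (V *ᵥ ψ) = born (Vᴴ * M * V) ψ := by
  rw [born_eq, born_eq, star_mulVec, ← dotProduct_mulVec, mulVec_mulVec, mulVec_mulVec]

theorem star_dotProduct_self_eq (w : ι → ℂ) : star w ⬝ᵥ w = ((∑ i, ‖w i‖ ^ 2 : ℝ) : ℂ) := by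
  push_cast
  exact Finset.sum_congr rfl fun x _ => Complex.conj_mul' _

theorem born_conjTranspose_mul_self (B : Matrix ι ι ℂ) (ψ : ι → ℂ) :
    born (Bᴴ * B) ψ = ∑ j, ‖(fun i => B j i) ⬝ᵥ ψ‖ ^ 2 := by
  rw [born_eq, ← mulVec_mulVec, dotProduct_mulVec, ← star_mulVec, star_dotProduct_self_eq,
    Complex.ofReal_re]
  rfl

theorem trace_conjTranspose_mul_self_re (B : Matrix ι ι ℂ) :
    ((Bᴴ * B).trace).re = ∑ j, ∑ i, ‖B j i‖ ^ 2 := by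
  have : (Bᴴ * B).trace = ((∑ i, ∑ j, ‖B j i‖ ^ 2 : ℝ) : ℂ) := by
    push_cast
    simp only [trace, diag, mul_apply, conjTranspose_apply]
    exact Finset.sum_congr rfl fun i _ => Finset.sum_congr rfl fun j _ => Complex.conj_mul' _
  rw [this, Complex.ofReal_re, Finset.sum_comm]

theorem trace_re_nonneg {M : Matrix ι ι ℂ} (hM : M.PosSemidef) : 0 ≤ (M.trace).re :=
  (Complex.nonneg_iff.mp hM.trace_nonneg).1

theorem list_prod_trace_nonneg {L : List (Matrix ι ι ℂ)} (hL : ∀ M ∈ L, M.PosSemidef) :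
    0 ≤ (L.map fun M => (M.trace).re).prod := by
  refine List.prod_nonneg fun x hx => ?_
  obtain ⟨M, hM, rfl⟩ := List.mem_map.mp hx
  exact trace_re_nonneg (hL M hM)

theorem list_prod_born_nonneg {L : List (Matrix ι ι ℂ)} (hL : ∀ M ∈ L, M.PosSemidef)
    (ψ : ι → ℂ) : 0 ≤ (L.map fun M => born M ψ).prod := by
  refine List.prod_nonneg fun x hx => ?_
  obtain ⟨M, hM, rfl⟩ := List.mem_map.mp hx
  exact born_nonneg (hL M hM) ψ

theorem continuous_list_prod_born (L : List (Matrix ι ι ℂ)) :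
    Continuous fun ψ : ι → ℂ => (L.map fun M => born M ψ).prod :=
  continuous_list_prod L fun M _ => continuous_born M

theorem list_prod_born_smul (L : List (Matrix ι ι ℂ)) (c : ℝ) (ψ : ι → ℂ) :
    (L.map fun M => born M ((c : ℂ) • ψ)).prod
      = (c ^ 2) ^ L.length * (L.map fun M => born M ψ).prod := by
  induction L with
  | nil => simp
  | cons M L ih =>
    rw [List.map_cons, List.prod_cons, ih, List.map_cons, List.prod_cons, List.length_cons,
      born_smul, pow_succ (c ^ 2)]
    ring

variable [DecidableEq ι]

/-- With M = BᴴB the Born weight is a sum of squared moduli of linear forms whose coefficient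
vectors are the rows of B, and tr M is the sum of their squared norms. Each form is absorbed into
the polynomial, which is why the induction carries an arbitrary `P`. -/
theorem fockNormSq_le_integral_born (L : List (Matrix ι ι ℂ)) (hL : ∀ M ∈ L, M.PosSemidef)
    (P : MvPolynomial ι ℂ) :
    Integrable (fun z => (L.map fun M => born M z).prod * ‖MvPolynomial.eval z P‖ ^ 2)
      (gaussVec ι) ∧
    (L.map fun M => (M.trace).re).prod * fockNormSq P ≤
      ∫ z, (L.map fun M => born M z).prod * ‖MvPolynomial.eval z P‖ ^ 2 ∂(gaussVec ι) := by
  induction L generalizing P with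
  | nil => simpa [fockNormSq] using integrable_normSq_eval P
  | cons M L ih =>
    have hL' : ∀ M ∈ L, M.PosSemidef := fun N hN => hL N (List.mem_cons_of_mem _ hN)
    obtain ⟨B, rfl⟩ : ∃ B : Matrix ι ι ℂ, M = Bᴴ * B := by
      open scoped MatrixOrder in
      obtain ⟨B, hB⟩ := CStarAlgebra.nonneg_iff_eq_star_mul_self.mp
        (Matrix.nonneg_iff_posSemidef.mpr (hL M List.mem_cons_self))
      exact ⟨B, hB⟩
    have hsplit : ∀ z : ι → ℂ, (((Bᴴ * B) :: L).map fun M => born M z).prod *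
        ‖MvPolynomial.eval z P‖ ^ 2 = ∑ j, (L.map fun M => born M z).prod *
        ‖MvPolynomial.eval z (linForm (fun i => B j i) * P)‖ ^ 2 := by
      intro z
      simp only [List.map_cons, List.prod_cons, born_conjTranspose_mul_self, map_mul, eval_linForm,
        norm_mul, mul_pow]
      rw [Finset.sum_mul, Finset.sum_mul]
      exact Finset.sum_congr rfl fun j _ => by ring
    simp only [hsplit]
    refine ⟨integrable_finsetSum _ fun j _ => (ih hL' _).1, ?_⟩
    rw [integral_finsetSum _ fun j _ => (ih hL' _).1]
    calc (((Bᴴ * B) :: L).map fun M => (M.trace).re).prod * fockNormSq P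
        = ∑ j, (L.map fun M => (M.trace).re).prod * ((∑ i, ‖B j i‖ ^ 2) * fockNormSq P) := by
          rw [List.map_cons, List.prod_cons, trace_conjTranspose_mul_self_re, Finset.sum_mul,
            Finset.sum_mul]
          exact Finset.sum_congr rfl fun j _ => by ring
      _ ≤ ∑ j, (L.map fun M => (M.trace).re).prod *
            fockNormSq (linForm (fun i => B j i) * P) :=
          Finset.sum_le_sum fun j _ => mul_le_mul_of_nonneg_left (fockNormSq_linForm_mul _ _)
            (list_prod_trace_nonneg hL')
      _ ≤ _ := Finset.sum_le_sum fun j _ => (ih hL' _).2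

omit [DecidableEq ι] in
theorem ascFactorial_card_pos [Nonempty ι] (k : ℕ) :
    0 < ((Fintype.card ι).ascFactorial k : ℝ) := by
  obtain ⟨m, hm⟩ := Nat.exists_eq_succ_of_ne_zero (Fintype.card_pos (α := ι)).ne'
  rw [hm]; exact_mod_cast Nat.ascFactorial_pos _ _

theorem prod_trace_le_integral_haarVec (o : ι) (L : List (Matrix ι ι ℂ))
    (hL : ∀ M ∈ L, M.PosSemidef) :
    (L.map fun M => (M.trace).re).prod / ((Fintype.card ι).ascFactorial L.length : ℕ) ≤
      ∫ ψ, (L.map fun M => born M ψ).prod ∂(haarVec o) := by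
  have : Nonempty ι := ⟨o⟩
  have hom := integral_gaussVec_of_homogeneous o L.length (continuous_list_prod_born L)
    (list_prod_born_nonneg hL) (fun c z _ => list_prod_born_smul L c z)
  have h := (fockNormSq_le_integral_born L hL 1).2
  have h1 : fockNormSq (1 : MvPolynomial ι ℂ) = 1 := by simp [fockNormSq]
  simp only [h1, map_one, norm_one, one_pow, mul_one] at h
  rw [div_le_iff₀ (ascFactorial_card_pos _), mul_comm, ← hom]
  exact h

end

/-! ### Product vectors -/

section
variable {K n : ℕ}

/-- The product vector `ψ₁ ⊗ ⋯ ⊗ ψ_K`. -/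
def tensorVec (ψ : Fin K → Fin n → ℂ) : (Fin K → Fin n) → ℂ := fun x => ∏ k, ψ k (x k)

theorem continuous_tensorVec : Continuous (tensorVec : (Fin K → Fin n → ℂ) → _) := by
  unfold tensorVec; fun_prop

theorem tensor_pureState (ψ : Fin K → Fin n → ℂ) :
    tensor (fun k => pureState (ψ k)) = pureState (tensorVec ψ) := by
  ext x y
  simp [tensor, pureState_apply, tensorVec, Finset.prod_mul_distrib]

theorem continuous_tensor :
    Continuous (tensor : (Fin K → Matrix (Fin n) (Fin n) ℂ) → _) := by
  unfold tensor
  refine continuous_matrix fun x y => ?_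
  simp only [Matrix.of_apply]
  fun_prop

/-- The law of `ψ₁ ⊗ ⋯ ⊗ ψ_K` for independent Haar random unit vectors. -/
noncomputable def productVec (K n : ℕ) [NeZero n] : Measure ((Fin K → Fin n) → ℂ) :=
  (Measure.pi fun _ : Fin K => haarVec (0 : Fin n)).map tensorVec

variable [NeZero n]

instance productVec_isProbabilityMeasure : IsProbabilityMeasure (productVec K n) :=
  Measure.isProbabilityMeasure_map continuous_tensorVec.measurable.aemeasurable

theorem haarProduct_eq_map : haarProduct K n = (productVec K n).map pureState := by
  unfold haarProduct productVec
  rw [Measure.map_map continuous_pureState.measurable continuous_tensorVec.measurable]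
  simp only [haarPure_eq_map]
  have : ∀ _ : Fin K, IsProbabilityMeasure ((haarVec (0 : Fin n)).map pureState) := fun _ =>
    Measure.isProbabilityMeasure_map continuous_pureState.measurable.aemeasurable
  have hmeas : Measurable fun (ψ : Fin K → Fin n → ℂ) k => pureState (ψ k) :=
    measurable_pi_lambda _ fun k => continuous_pureState.measurable.comp (measurable_pi_apply k)
  rw [← Measure.pi_map_pi (f := fun _ => pureState)
    (fun _ => continuous_pureState.measurable.aemeasurable),
    Measure.map_map continuous_tensor.measurable hmeas]
  congr 1
  funext ψ
  exact tensor_pureState ψ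

theorem pi_haarVec_eq_map : (Measure.pi fun _ : Fin K => haarVec (0 : Fin n)) =
    (Measure.pi fun _ : Fin K => haarUnitary (Fin n)).map fun U k => unitaryCol 0 (U k) := by
  unfold haarVec
  have : ∀ _ : Fin K, IsProbabilityMeasure ((haarUnitary (Fin n)).map (unitaryCol 0)) := fun _ =>
    Measure.isProbabilityMeasure_map (continuous_unitaryCol 0).measurable.aemeasurable
  rw [← Measure.pi_map_pi (f := fun _ => unitaryCol 0)
    (fun _ => (continuous_unitaryCol 0).measurable.aemeasurable)]

instance unitaryGroup_secondCountableTopology {ι : Type} [Fintype ι] [DecidableEq ι] :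
    SecondCountableTopology (Matrix.unitaryGroup ι ℂ) :=
  TopologicalSpace.Subtype.secondCountableTopology _

theorem continuous_pi_unitaryCol : Continuous
    fun (U : Fin K → Matrix.unitaryGroup (Fin n) ℂ) k => unitaryCol (0 : Fin n) (U k) :=
  continuous_pi fun k => (continuous_unitaryCol 0).comp (continuous_apply k)

theorem integrable_pi_haarVec {f : (Fin K → Fin n → ℂ) → ℝ} (hf : Continuous f) :
    Integrable f (Measure.pi fun _ : Fin K => haarVec (0 : Fin n)) := by
  rw [pi_haarVec_eq_map, integrable_map_measure hf.aestronglyMeasurable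
    continuous_pi_unitaryCol.measurable.aemeasurable]
  exact (hf.comp continuous_pi_unitaryCol).integrable_of_hasCompactSupport
    (HasCompactSupport.of_compactSpace _)

theorem integrable_productVec {f : ((Fin K → Fin n) → ℂ) → ℝ} (hf : Continuous f) :
    Integrable f (productVec K n) := by
  unfold productVec
  rw [integrable_map_measure hf.aestronglyMeasurable continuous_tensorVec.measurable.aemeasurable]
  exact integrable_pi_haarVec (hf.comp continuous_tensorVec)

theorem integral_productVec {f : ((Fin K → Fin n) → ℂ) → ℝ} (hf : Continuous f) :
    ∫ φ, f φ ∂(productVec K n) =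
      ∫ ψ, f (tensorVec ψ) ∂(Measure.pi fun _ : Fin K => haarVec (0 : Fin n)) :=
  integral_map continuous_tensorVec.measurable.aemeasurable hf.aestronglyMeasurable

omit [NeZero n] in
/-- Partial trace over all tensor factors but the first. -/
def partialTrace (M : Matrix (Fin (K + 1) → Fin n) (Fin (K + 1) → Fin n) ℂ) :
    Matrix (Fin n) (Fin n) ℂ :=
  ∑ y : Fin K → Fin n, M.submatrix (fun a => Fin.cons a y) (fun a => Fin.cons a y)

omit [NeZero n] in
theorem partialTrace_posSemidef {M : Matrix (Fin (K + 1) → Fin n) (Fin (K + 1) → Fin n) ℂ}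
    (hM : M.PosSemidef) : (partialTrace M).PosSemidef :=
  Matrix.posSemidef_sum _ fun _ _ => hM.submatrix _

omit [NeZero n] in
theorem sum_consEquiv {E : Type*} [AddCommMonoid E] (f : (Fin (K + 1) → Fin n) → E) :
    ∑ x, f x = ∑ a : Fin n, ∑ y : Fin K → Fin n, f (Fin.cons a y) := by
  rw [← Fintype.sum_prod_type']
  exact (Fintype.sum_equiv (Fin.consEquiv fun _ => Fin n) _ _ fun _ => rfl).symm

omit [NeZero n] in
theorem trace_partialTrace (M : Matrix (Fin (K + 1) → Fin n) (Fin (K + 1) → Fin n) ℂ) :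
    (partialTrace M).trace = M.trace := by
  rw [trace, trace, sum_consEquiv]
  simp [partialTrace, Matrix.sum_apply]

omit [NeZero n] in
/-- The map `ψ ↦ φ ⊗ ψ`. -/
def tensorLeft (K : ℕ) (φ : Fin n → ℂ) : Matrix (Fin (K + 1) → Fin n) (Fin K → Fin n) ℂ :=
  Matrix.of fun x y => if Fin.tail x = y then φ (x 0) else 0

omit [NeZero n] in
theorem tensorLeft_mulVec (φ : Fin n → ℂ) (ψ : Fin K → Fin n → ℂ) :
    tensorLeft K φ *ᵥ tensorVec ψ = tensorVec (Fin.cons φ ψ : Fin (K + 1) → Fin n → ℂ) := by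
  funext x
  simp [tensorLeft, mulVec, dotProduct, tensorVec, Fin.prod_univ_succ, Fin.tail]

omit [NeZero n] in
-- Fixing the first tensor factor compresses M to the remaining ones; identifying the trace of the
-- compression with a Born weight of the partial trace is what lets the one-system inequality be
-- iterated.
theorem trace_tensorLeft (M : Matrix (Fin (K + 1) → Fin n) (Fin (K + 1) → Fin n) ℂ)
    (φ : Fin n → ℂ) :
    ((tensorLeft K φ)ᴴ * M * tensorLeft K φ).trace.re = born (partialTrace M) φ := by
  rw [born_eq]
  congr 1
  have h : ∀ y, ((tensorLeft K φ)ᴴ * M * tensorLeft K φ) y y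
      = ∑ a, ∑ b, star (φ a) * M (Fin.cons a y) (Fin.cons b y) * φ b := by
    intro y
    simp only [mul_apply, conjTranspose_apply, tensorLeft, Matrix.of_apply, sum_consEquiv,
      Fin.tail_cons, Fin.cons_zero]
    simp only [apply_ite star, star_zero, ite_mul, zero_mul, mul_ite, mul_zero, Finset.sum_ite_eq',
      Finset.mem_univ, if_true, Finset.sum_mul]
    exact Finset.sum_comm
  simp only [trace, diag, h, dotProduct, mulVec, partialTrace, Matrix.sum_apply, submatrix_apply]
  rw [Finset.sum_comm]
  refine Finset.sum_congr rfl fun a _ => ?_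
  rw [Finset.sum_comm, Finset.mul_sum]
  refine Finset.sum_congr rfl fun b _ => ?_
  rw [Finset.sum_mul, Finset.mul_sum]
  exact Finset.sum_congr rfl fun y _ => by simp only [Pi.star_apply]; ring

/-- For a fixed first factor φ the induction hypothesis applies to the compressed matrices. Their
traces are Born weights of the partial traces at φ, so averaging over φ is the one-system
inequality, and partial traces keep the trace. -/
theorem prod_trace_le_integral_tensorVec (K : ℕ)
    (L : List (Matrix (Fin K → Fin n) (Fin K → Fin n) ℂ)) (hL : ∀ M ∈ L, M.PosSemidef) :
    (L.map fun M => (M.trace).re).prod / ((n.ascFactorial L.length : ℕ) : ℝ) ^ K ≤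
      ∫ ψ, (L.map fun M => born M (tensorVec ψ)).prod
        ∂(Measure.pi fun _ : Fin K => haarVec (0 : Fin n)) := by
  have hasc : 0 < (n.ascFactorial L.length : ℝ) := by
    have := ascFactorial_card_pos (ι := Fin n) L.length
    rwa [Fintype.card_fin] at this
  induction K with
  | zero =>
    have h : ∀ (M : Matrix (Fin 0 → Fin n) (Fin 0 → Fin n) ℂ) (ψ : Fin 0 → Fin n → ℂ),
        born M (tensorVec ψ) = (M.trace).re := by
      intro M ψ
      rw [born_eq]
      simp [tensorVec, dotProduct, mulVec, trace]
    simp [h]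
  | succ K ih =>
    have hmp := measurePreserving_piFinSuccAbove (fun _ : Fin (K + 1) => haarVec (0 : Fin n)) 0
    have hcont : Continuous fun ψ : Fin (K + 1) → Fin n → ℂ =>
        (L.map fun M => born M (tensorVec ψ)).prod :=
      (continuous_list_prod_born L).comp continuous_tensorVec
    have hint := hmp.symm.integrable_comp_of_integrable (integrable_pi_haarVec hcont)
    rw [← hmp.symm.integral_comp']
    refine le_of_le_of_eq ?_ (integral_prod _ hint).symm
    have hcons : ∀ (φ : Fin n → ℂ) (ψ : Fin K → Fin n → ℂ),
        (MeasurableEquiv.piFinSuccAbove (fun _ => Fin n → ℂ) (0 : Fin (K + 1))).symm (φ, ψ)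
          = Fin.cons φ ψ := by
      intro φ ψ
      simp [MeasurableEquiv.piFinSuccAbove_symm_apply, Fin.insertNthEquiv]
    simp only [Function.comp_def, hcons]
    have hin : ∀ φ : Fin n → ℂ,
        (L.map fun M => born (partialTrace M) φ).prod / ((n.ascFactorial L.length : ℕ) : ℝ) ^ K ≤
        ∫ ψ, (L.map fun M => born M (tensorVec (Fin.cons φ ψ : Fin (K + 1) → Fin n → ℂ))).prod
          ∂(Measure.pi fun _ : Fin K => haarVec (0 : Fin n)) := by
      intro φ
      have := ih (L.map fun M => (tensorLeft K φ)ᴴ * M * tensorLeft K φ) (by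
        intro M hM
        obtain ⟨N, hN, rfl⟩ := List.mem_map.mp hM
        exact (hL N hN).conjTranspose_mul_mul_same _) (by simpa using hasc)
      simp only [List.map_map, Function.comp_def, trace_tensorLeft, List.length_map, ← born_mulVec,
        tensorLeft_mulVec] at this
      exact this
    have hout := prod_trace_le_integral_haarVec (0 : Fin n) (L.map partialTrace) (by
        intro M hM
        obtain ⟨N, hN, rfl⟩ := List.mem_map.mp hM
        exact partialTrace_posSemidef (hL N hN))
    simp only [List.map_map, Function.comp_def, trace_partialTrace, List.length_map,
      Fintype.card_fin] at hout
    calc _ = (L.map fun M => (M.trace).re).prod / (n.ascFactorial L.length : ℕ) /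
            ((n.ascFactorial L.length : ℕ) : ℝ) ^ K := by
          rw [div_div, pow_succ']
      _ ≤ (∫ φ, (L.map fun M => born (partialTrace M) φ).prod ∂(haarVec (0 : Fin n))) /
            ((n.ascFactorial L.length : ℕ) : ℝ) ^ K := by gcongr
      _ = ∫ φ, (L.map fun M => born (partialTrace M) φ).prod /
            ((n.ascFactorial L.length : ℕ) : ℝ) ^ K ∂(haarVec (0 : Fin n)) := by
          rw [integral_div]
      _ ≤ _ := by
          refine integral_mono ?_ ?_ hin
          · refine integrable_haarVec _ ?_
            have := continuous_list_prod_born (L.map partialTrace)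
            simp only [List.map_map, Function.comp_def] at this
            exact this.div_const _
          · have := hint.integral_prod_left
            simp only [Function.comp_def, hcons] at this
            exact this

theorem prod_trace_le_integral_productVec
    (L : List (Matrix (Fin K → Fin n) (Fin K → Fin n) ℂ)) (hL : ∀ M ∈ L, M.PosSemidef) :
    (L.map fun M => (M.trace).re).prod / ((n.ascFactorial L.length : ℕ) : ℝ) ^ K ≤
      ∫ φ, (L.map fun M => born M φ).prod ∂(productVec K n) := by
  rw [integral_productVec (continuous_list_prod_born L)]
  exact prod_trace_le_integral_tensorVec K L hL

end

/-! ### The lower bound -/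

section
variable {ι : Type} [Fintype ι] [DecidableEq ι]

/-- The mean of `φ(Ĉ)` when the protocol is run on copies of `ρ`. -/
noncomputable def Protocol.leafMean (φ : ℝ → ℝ) (ρ : Matrix ι ι ℂ) : {T : ℕ} → Protocol ι T → ℝ
  | _, .leaf value => φ value
  | _, .node M next => ∑ i, ((M.elem i * ρ).trace).re * (next i).leafMean φ ρ

/-- The indicator function of the negative reals. -/
noncomputable def negInd (x : ℝ) : ℝ := if x < 0 then 1 else 0

theorem negInd_nonneg (x : ℝ) : 0 ≤ negInd x := by unfold negInd; split_ifs <;> norm_num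

theorem negInd_le_one (x : ℝ) : negInd x ≤ 1 := by unfold negInd; split_ifs <;> norm_num

theorem Protocol.probNeg_eq_leafMean (ρ : Matrix ι ι ℂ) {T : ℕ} (P : Protocol ι T) :
    P.probNeg ρ = P.leafMean negInd ρ := by
  induction P with
  | leaf v => rfl
  | node M next ih => simp only [Protocol.probNeg, Protocol.leafMean, ih]

theorem Protocol.continuous_leafMean (φ : ℝ → ℝ) {T : ℕ} (P : Protocol ι T) :
    Continuous fun ρ => P.leafMean φ ρ := by
  induction P with
  | leaf v => exact continuous_const
  | node M next ih =>
    simp only [Protocol.leafMean]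
    exact continuous_finsetSum _ fun i _ =>
      (Complex.continuous_re.comp (continuous_const.mul continuous_id).matrix_trace).mul (ih i)

theorem Protocol.continuous_probNeg {T : ℕ} (P : Protocol ι T) :
    Continuous fun ρ => P.probNeg ρ := by
  simp only [Protocol.probNeg_eq_leafMean]
  exact P.continuous_leafMean _

theorem POVM.sum_trace_mul {m : ℕ} (M : POVM ι m) (ρ : Matrix ι ι ℂ) :
    ∑ i, ((M.elem i * ρ).trace).re = (ρ.trace).re := by
  rw [← Complex.re_sum, ← trace_sum, ← Finset.sum_mul, M.sum_eq_one, one_mul]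

/-- Rejection is thus also a leaf mean of a nonnegative function, so one lower bound on leaf means
controls acceptance from both sides. -/
theorem Protocol.leafMean_one_sub (φ : ℝ → ℝ) {ρ : Matrix ι ι ℂ} (hρ : ρ.trace = 1) {T : ℕ}
    (P : Protocol ι T) : P.leafMean (fun x => 1 - φ x) ρ = 1 - P.leafMean φ ρ := by
  induction P with
  | leaf v => rfl
  | node M next ih =>
    simp only [Protocol.leafMean, ih, mul_sub, mul_one, Finset.sum_sub_distrib]
    rw [M.sum_trace_mul, hρ, Complex.one_re]

theorem Protocol.leafMean_nonneg {φ : ℝ → ℝ} (hφ : ∀ x, 0 ≤ φ x) {ρ : Matrix ι ι ℂ}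
    (hρ : ∀ M : Matrix ι ι ℂ, M.PosSemidef → 0 ≤ ((M * ρ).trace).re) {T : ℕ} (P : Protocol ι T) :
    0 ≤ P.leafMean φ ρ := by
  induction P with
  | leaf v => exact hφ v
  | node M next ih =>
    exact Finset.sum_nonneg fun i _ => mul_nonneg (hρ _ (M.posSemidef i)) (ih i)

theorem Protocol.probNeg_mem_Icc {ρ : Matrix ι ι ℂ}
    (hρ : ∀ M : Matrix ι ι ℂ, M.PosSemidef → 0 ≤ ((M * ρ).trace).re) (htr : ρ.trace = 1)
    {T : ℕ} (P : Protocol ι T) : 0 ≤ P.probNeg ρ ∧ P.probNeg ρ ≤ 1 := by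
  rw [Protocol.probNeg_eq_leafMean]
  refine ⟨P.leafMean_nonneg negInd_nonneg hρ, ?_⟩
  have h := P.leafMean_nonneg (φ := fun x => 1 - negInd x)
    (fun x => sub_nonneg.mpr (negInd_le_one x)) hρ
  rw [P.leafMean_one_sub _ htr] at h
  linarith

theorem trace_mul_maximallyMixed_re (M : Matrix ι ι ℂ) :
    ((M * ((Fintype.card ι : ℂ)⁻¹ • (1 : Matrix ι ι ℂ))).trace).re
      = (M.trace).re / (Fintype.card ι : ℝ) := by
  rw [mul_smul_comm, mul_one, trace_smul, smul_eq_mul, mul_comm, ← div_eq_mul_inv,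
    Complex.div_natCast_re]

/-- The list `L` records the POVM elements met on the path from the root. At a leaf the product of
normalised traces is the probability of that path in the maximally mixed state, so the hypothesis
compares path by path, whatever the adaptive choices. -/
theorem Protocol.mul_leafMean_le_integral {ν : Measure (ι → ℂ)}
    (hint : ∀ f : (ι → ℂ) → ℝ, Continuous f → Integrable f ν) (κ : ℝ) (N : ℕ)
    (hν : ∀ L : List (Matrix ι ι ℂ), L.length = N → (∀ M ∈ L, M.PosSemidef) →
      κ * (L.map fun M => (M.trace).re / (Fintype.card ι : ℝ)).prod ≤
        ∫ ψ, (L.map fun M => born M ψ).prod ∂ν)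
    {φ : ℝ → ℝ} (hφ : ∀ x, 0 ≤ φ x) {T : ℕ} (P : Protocol ι T) (L : List (Matrix ι ι ℂ))
    (hlen : L.length + T = N) (hL : ∀ M ∈ L, M.PosSemidef) :
    κ * (L.map fun M => (M.trace).re / (Fintype.card ι : ℝ)).prod *
        P.leafMean φ ((Fintype.card ι : ℂ)⁻¹ • (1 : Matrix ι ι ℂ)) ≤
      ∫ ψ, (L.map fun M => born M ψ).prod * P.leafMean φ (pureState ψ) ∂ν := by
  induction P generalizing L with
  | leaf v =>
    simp only [Protocol.leafMean]
    rw [integral_mul_const]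
    exact mul_le_mul_of_nonneg_right (hν L (by simpa using hlen) hL) (hφ v)
  | @node T m M next ih =>
    simp only [Protocol.leafMean]
    have hsplit : ∀ ψ : ι → ℂ, (L.map fun M => born M ψ).prod *
        ∑ i, ((M.elem i * pureState ψ).trace).re * (next i).leafMean φ (pureState ψ)
        = ∑ i, ((M.elem i :: L).map fun M => born M ψ).prod *
            (next i).leafMean φ (pureState ψ) := by
      intro ψ
      rw [Finset.mul_sum]
      refine Finset.sum_congr rfl fun i _ => ?_
      rw [List.map_cons, List.prod_cons, born]
      ring
    simp only [hsplit]
    rw [integral_finsetSum]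
    · rw [Finset.mul_sum]
      refine Finset.sum_le_sum fun i _ => ?_
      have h := ih i (M.elem i :: L) (by simp only [List.length_cons]; omega) (by
        intro A hA
        rcases List.mem_cons.mp hA with rfl | hA
        · exact M.posSemidef i
        · exact hL A hA)
      refine le_trans (le_of_eq ?_) h
      rw [trace_mul_maximallyMixed_re, List.map_cons, List.prod_cons]
      ring
    · intro i _
      exact hint _ ((continuous_list_prod_born _).mul
        (((next i).continuous_leafMean φ).comp continuous_pureState))

omit [DecidableEq ι] in
theorem trace_pureState (ψ : ι → ℂ) : (pureState ψ).trace = ((∑ i, ‖ψ i‖ ^ 2 : ℝ) : ℂ) := by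
  rw [pureState, trace_vecMulVec, ← dotProduct_comm, star_dotProduct_self_eq]

/-- Sandwich bounds for the acceptance probability of a protocol in a random pure state. -/
theorem Protocol.integral_probNeg_bounds {ν : Measure (ι → ℂ)} [IsProbabilityMeasure ν]
    [Nonempty ι]
    (hint : ∀ f : (ι → ℂ) → ℝ, Continuous f → Integrable f ν)
    (hnorm : ∀ᵐ ψ ∂ν, ∑ i, ‖ψ i‖ ^ 2 = 1) (κ : ℝ) {T : ℕ}
    (hν : ∀ L : List (Matrix ι ι ℂ), L.length = T → (∀ M ∈ L, M.PosSemidef) →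
      κ * (L.map fun M => (M.trace).re / (Fintype.card ι : ℝ)).prod ≤
        ∫ ψ, (L.map fun M => born M ψ).prod ∂ν)
    (P : Protocol ι T) :
    κ * P.probNeg ((Fintype.card ι : ℂ)⁻¹ • (1 : Matrix ι ι ℂ)) ≤
        ∫ ψ, P.probNeg (pureState ψ) ∂ν ∧
      ∫ ψ, P.probNeg (pureState ψ) ∂ν ≤
        1 - κ * (1 - P.probNeg ((Fintype.card ι : ℂ)⁻¹ • (1 : Matrix ι ι ℂ))) := by
  have hmix : ((Fintype.card ι : ℂ)⁻¹ • (1 : Matrix ι ι ℂ)).trace = 1 := by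
    rw [trace_smul, trace_one, smul_eq_mul, inv_mul_cancel₀]
    exact_mod_cast Fintype.card_ne_zero
  simp only [Protocol.probNeg_eq_leafMean]
  constructor
  · simpa using P.mul_leafMean_le_integral hint κ T hν negInd_nonneg [] (by simp) (by simp)
  -- The upper bound on acceptance is the lower bound on rejection.
  · have h := P.mul_leafMean_le_integral hint κ T hν (φ := fun x => 1 - negInd x)
      (fun x => sub_nonneg.mpr (negInd_le_one x)) [] (by simp) (by simp)
    simp only [List.map_nil, List.prod_nil, mul_one, one_mul] at h
    rw [P.leafMean_one_sub _ hmix] at h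
    have hae : ∀ᵐ ψ ∂ν, P.leafMean (fun x => 1 - negInd x) (pureState ψ)
        = 1 - P.leafMean negInd (pureState ψ) := by
      filter_upwards [hnorm] with ψ hψ
      exact P.leafMean_one_sub _ (by rw [trace_pureState, hψ]; simp)
    have hi : Integrable (fun ψ => P.leafMean negInd (pureState ψ)) ν :=
      hint _ ((P.continuous_leafMean _).comp continuous_pureState)
    rw [integral_congr_ae hae, integral_sub (integrable_const _) hi] at h
    simp at h
    linarith

end

theorem list_prod_map_div {α : Type*} (L : List α) (f : α → ℝ) (D : ℝ) :
    (L.map fun x => f x / D).prod = (L.map f).prod / D ^ L.length := by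
  induction L with
  | nil => simp
  | cons x L ih => simp only [List.map_cons, List.prod_cons, ih, List.length_cons, pow_succ']; ring

/-- Each of the T factors of the ascending factorial is at most n + T; Bernoulli's inequality does
the rest. -/
theorem one_sub_le_pow_div_ascFactorial {n : ℕ} (hn : 0 < n) (T : ℕ) :
    1 - (T : ℝ) ^ 2 / n ≤ (n : ℝ) ^ T / (n.ascFactorial T : ℕ) := by
  have hn' : (0 : ℝ) < n := by exact_mod_cast hn
  have h1 : (n.ascFactorial T : ℝ) ≤ ((n : ℝ) + T) ^ T := by
    have : n.ascFactorial T ≤ (n + T) ^ T := by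
      obtain ⟨m, rfl⟩ := Nat.exists_eq_succ_of_ne_zero hn.ne'
      exact (Nat.ascFactorial_le_pow_add m T).trans (Nat.pow_le_pow_left (by omega) _)
    exact_mod_cast this
  have h2 : (0 : ℝ) < (n.ascFactorial T : ℕ) := by
    obtain ⟨m, rfl⟩ := Nat.exists_eq_succ_of_ne_zero hn.ne'
    exact_mod_cast Nat.ascFactorial_pos _ _
  have hTn : (0 : ℝ) < n + T := by positivity
  calc 1 - (T : ℝ) ^ 2 / n ≤ 1 + (T : ℝ) * (-(T / (n + T))) := by
        have : (T : ℝ) * (T / (n + T)) ≤ T ^ 2 / n := by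
          rw [← mul_div_assoc, ← sq]
          exact div_le_div_of_nonneg_left (by positivity) hn' (by simp)
        linarith
    _ ≤ (1 + -((T : ℝ) / (n + T))) ^ T := by
        refine one_add_mul_le_pow ?_ T
        have : (T : ℝ) / (n + T) ≤ 1 := by rw [div_le_one hTn]; simp
        linarith
    _ = (n : ℝ) ^ T / (n + T) ^ T := by
        rw [← div_pow]; congr 1; field_simp; ring
    _ ≤ _ := div_le_div_of_nonneg_left (by positivity) h2 h1

section
variable {K n : ℕ} [NeZero n]

theorem ae_productVec_sum_normSq : ∀ᵐ φ ∂(productVec K n), ∑ x, ‖φ x‖ ^ 2 = 1 := by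
  have hclosed : IsClosed {φ : (Fin K → Fin n) → ℂ | ∑ x, ‖φ x‖ ^ 2 = 1} :=
    isClosed_eq (by fun_prop) continuous_const
  unfold productVec
  rw [ae_map_iff continuous_tensorVec.measurable.aemeasurable hclosed.measurableSet,
    pi_haarVec_eq_map]
  refine (ae_map_iff continuous_pi_unitaryCol.measurable.aemeasurable
    (hclosed.preimage continuous_tensorVec).measurableSet).mpr ?_
  refine Filter.Eventually.of_forall fun U => ?_
  change ∑ x : Fin K → Fin n, ‖tensorVec (fun k => unitaryCol 0 (U k)) x‖ ^ 2 = 1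
  simp only [tensorVec, norm_prod, ← Finset.prod_pow]
  rw [← Fintype.piFinset_univ, ← Finset.prod_univ_sum (fun _ => Finset.univ)
    (fun k i => ‖unitaryCol 0 (U k) i‖ ^ 2)]
  simp [sum_normSq_unitaryCol]

/-- Mean acceptance probability for a Haar random pure state. -/
noncomputable def Protocol.meanHaar {T : ℕ} (P : Protocol (Fin K → Fin n) T) : ℝ :=
  ∫ ψ, P.probNeg (pureState ψ) ∂(haarVec (fun _ => 0 : Fin K → Fin n))

/-- Mean acceptance probability for a random product state. -/
noncomputable def Protocol.meanProduct {T : ℕ} (P : Protocol (Fin K → Fin n) T) : ℝ :=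
  ∫ ψ, P.probNeg (pureState ψ) ∂(productVec K n)

/-- A protocol that tells Haar random states from random product states needs `Ω(√n)` copies. -/
theorem Protocol.meanHaar_sub_meanProduct_le (hK : 1 ≤ K) {T : ℕ}
    (P : Protocol (Fin K → Fin n) T) :
    P.meanHaar - P.meanProduct ≤ K * ((T : ℝ) ^ 2 / n) := by
  have hn : 0 < n := Nat.pos_of_ne_zero (NeZero.ne n)
  have hn' : (1 : ℝ) ≤ n := by exact_mod_cast hn
  have hcard : Fintype.card (Fin K → Fin n) = n ^ K := by simp
  have hD : 0 < n ^ K := pow_pos hn K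
  set D : ℕ := n ^ K with hDdef
  have hDn : (n : ℝ) ≤ D := by
    rw [hDdef]; push_cast
    exact le_self_pow₀ hn' (by omega)
  have hascn : (0 : ℝ) < (n.ascFactorial T : ℕ) := by
    have := ascFactorial_card_pos (ι := Fin n) T
    rwa [Fintype.card_fin] at this
  obtain ⟨-, hH⟩ := P.integral_probNeg_bounds
    (fun f hf => integrable_haarVec (fun _ => 0 : Fin K → Fin n) hf)
    (ae_haarVec_sum_normSq _) ((D : ℝ) ^ T / (D.ascFactorial T : ℕ)) (by
      intro L hlen hL
      have h := prod_trace_le_integral_haarVec (fun _ => 0 : Fin K → Fin n) L hL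
      refine le_trans (le_of_eq ?_) h
      rw [list_prod_map_div, hcard, hlen]
      have : (D : ℝ) ^ T ≠ 0 := by positivity
      field_simp)
  obtain ⟨hP, -⟩ := P.integral_probNeg_bounds
    (fun f hf => integrable_productVec hf)
    ae_productVec_sum_normSq (((n : ℝ) ^ T / (n.ascFactorial T : ℕ)) ^ K) (by
      intro L hlen hL
      have h := prod_trace_le_integral_productVec L hL
      refine le_trans (le_of_eq ?_) h
      rw [list_prod_map_div, hcard, hlen, div_pow, hDdef]
      have : (n : ℝ) ^ T ≠ 0 := by positivity
      push_cast
      rw [← pow_mul, ← pow_mul, mul_comm K T]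
      field_simp)
  set p := P.probNeg ((Fintype.card (Fin K → Fin n) : ℂ)⁻¹ •
    (1 : Matrix (Fin K → Fin n) (Fin K → Fin n) ℂ)) with hp
  have hmix : ((Fintype.card (Fin K → Fin n) : ℂ)⁻¹ •
    (1 : Matrix (Fin K → Fin n) (Fin K → Fin n) ℂ)).trace = 1 := by
    rw [trace_smul, trace_one, smul_eq_mul, inv_mul_cancel₀]
    exact_mod_cast Fintype.card_ne_zero
  have hp01 : 0 ≤ p ∧ p ≤ 1 := P.probNeg_mem_Icc (fun M hM => by
    rw [trace_mul_maximallyMixed_re]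
    exact div_nonneg (trace_re_nonneg hM) (Nat.cast_nonneg _)) hmix
  have hκ1 := one_sub_le_pow_div_ascFactorial hD T
  have hκ2 := one_sub_le_pow_div_ascFactorial hn T
  set κ1 := (D : ℝ) ^ T / (D.ascFactorial T : ℕ)
  set κ2 := (n : ℝ) ^ T / (n.ascFactorial T : ℕ)
  have hx : 0 ≤ (T : ℝ) ^ 2 / n := by positivity
  have hκ2n : 0 ≤ κ2 := by positivity
  have hK' : (1 : ℝ) ≤ K := by exact_mod_cast hK
  have h1 : 1 - K * ((T : ℝ) ^ 2 / n) ≤ κ1 := by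
    have : (T : ℝ) ^ 2 / D ≤ T ^ 2 / n :=
      div_le_div_of_nonneg_left (by positivity) (by positivity) hDn
    nlinarith
  -- Bernoulli's inequality needs T²/n ≤ 1; otherwise the left side is at most zero.
  have h2 : 1 - K * ((T : ℝ) ^ 2 / n) ≤ κ2 ^ K := by
    by_cases hle : (T : ℝ) ^ 2 / n ≤ 1
    · calc 1 - K * ((T : ℝ) ^ 2 / n) = 1 + K * (-((T : ℝ) ^ 2 / n)) := by ring
        _ ≤ (1 + -((T : ℝ) ^ 2 / n)) ^ K := one_add_mul_le_pow (by linarith) K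
        _ ≤ κ2 ^ K := pow_le_pow_left₀ (by linarith) (by linarith) K
    · have : 0 ≤ κ2 ^ K := by positivity
      nlinarith
  -- With ε = K T²/n, the difference is at most 1 - (1-ε)(1-p) - (1-ε)p = ε.
  unfold Protocol.meanHaar Protocol.meanProduct
  nlinarith [mul_le_mul_of_nonneg_right h1 (sub_nonneg.mpr hp01.2),
    mul_le_mul_of_nonneg_right h2 hp01.1]

end

/-! ### Haar random pure states are entangled -/

section
variable {K n : ℕ}

theorem tensor_conjTranspose_mul_self (B : Fin K → Matrix (Fin n) (Fin n) ℂ) :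
    tensor (fun k => (B k)ᴴ * B k) = (tensor B)ᴴ * tensor B := by
  ext x y
  simp only [tensor, Matrix.of_apply, mul_apply, conjTranspose_apply, star_prod,
    ← Finset.prod_mul_distrib]
  rw [Finset.prod_univ_sum, Fintype.piFinset_univ]

theorem tensor_posSemidef {σ : Fin K → Matrix (Fin n) (Fin n) ℂ} (hσ : ∀ k, (σ k).PosSemidef) :
    (tensor σ).PosSemidef := by
  have h : ∀ k, ∃ B : Matrix (Fin n) (Fin n) ℂ, σ k = Bᴴ * B := fun k => by
    open scoped MatrixOrder in
    exact CStarAlgebra.nonneg_iff_eq_star_mul_self.mp (Matrix.nonneg_iff_posSemidef.mpr (hσ k))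
  choose B hB using h
  rw [funext hB, tensor_conjTranspose_mul_self]
  exact posSemidef_conjTranspose_mul_self _

theorem trace_tensor (σ : Fin K → Matrix (Fin n) (Fin n) ℂ) :
    (tensor σ).trace = ∏ k, (σ k).trace := by
  simp only [trace, diag, tensor, Matrix.of_apply]
  rw [Finset.prod_univ_sum, Fintype.piFinset_univ]

theorem pureState_posSemidef {ι : Type} [Fintype ι] (φ : ι → ℂ) : (pureState φ).PosSemidef :=
  posSemidef_vecMulVec_self_star φ

theorem isDensity_pureState {ι : Type} [Fintype ι] {φ : ι → ℂ} (hφ : ∑ i, ‖φ i‖ ^ 2 = 1) :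
    IsDensity (pureState φ) :=
  ⟨pureState_posSemidef φ, by rw [trace_pureState, hφ]; simp⟩

/-- A positive matrix whose kernel contains the orthogonal complement of a unit vector. -/
theorem eq_pureState_of_mulVec_eq_zero {ι : Type} [Fintype ι] [DecidableEq ι]
    {φ : ι → ℂ} (hφ : ∑ i, ‖φ i‖ ^ 2 = 1)
    {B : Matrix ι ι ℂ} (hB : B.PosSemidef) (htr : B.trace = 1)
    (h : ∀ v : ι → ℂ, star φ ⬝ᵥ v = 0 → B *ᵥ v = 0) : B = pureState φ := by
  have hφ' : star φ ⬝ᵥ φ = 1 := by rw [star_dotProduct_self_eq, hφ]; simp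
  have h1 : B = B * pureState φ := by
    refine Matrix.ext_of_mulVec_single fun j => ?_
    have h2 := h (Pi.single j 1 - pureState φ *ᵥ Pi.single j 1) (by
      rw [dotProduct_sub, pureState, vecMulVec_mulVec, dotProduct_smul, hφ']
      simp)
    rw [mulVec_sub, mulVec_mulVec, sub_eq_zero] at h2
    exact h2
  have hsa : (pureState φ)ᴴ = pureState φ := (pureState_posSemidef φ).isHermitian
  have h2 : B = pureState φ * B := by
    have := congrArg conjTranspose h1
    rwa [conjTranspose_mul, hsa, hB.isHermitian.eq] at this
  have h3 : B = (star φ ⬝ᵥ (B *ᵥ φ)) • pureState φ := by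
    conv_lhs => rw [h2, h1]
    rw [pureState, mul_vecMulVec, vecMulVec_mul_vecMulVec, vecMulVec_smul]
  have h4 : star φ ⬝ᵥ (B *ᵥ φ) = 1 := by
    have := congrArg trace h3
    rw [trace_smul, htr, trace_pureState, hφ] at this
    simpa using this.symm
  rw [h3, h4, one_smul]

/-- Pure states are extreme points. A vector orthogonal to φ has expectation zero in the mixture,
hence in every component of positive weight, and positivity puts it in the kernel of that component.
-/
theorem exists_tensor_eq_of_isSeparable {φ : (Fin K → Fin n) → ℂ} (hφ : ∑ x, ‖φ x‖ ^ 2 = 1)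
    (h : IsSeparable (pureState φ)) :
    ∃ σ : Fin K → Matrix (Fin n) (Fin n) ℂ, pureState φ = tensor σ := by
  obtain ⟨m, p, σ, hp, hsum, hσ, heq⟩ := h
  obtain ⟨i, -, hi⟩ : ∃ i ∈ Finset.univ, 0 < p i := by
    by_contra hcon
    push Not at hcon
    have := Finset.sum_nonpos hcon
    linarith
  refine ⟨σ i, (eq_pureState_of_mulVec_eq_zero hφ (tensor_posSemidef fun k => (hσ i k).1) ?_ ?_).symm⟩
  · rw [trace_tensor]
    exact Finset.prod_eq_one fun k _ => (hσ i k).2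
  · intro v hv
    have hB : ∀ j, (tensor (σ j)).PosSemidef := fun j => tensor_posSemidef fun k => (hσ j k).1
    rw [← (hB i).dotProduct_mulVec_zero_iff]
    have h0 : star v ⬝ᵥ (pureState φ *ᵥ v) = 0 := by
      rw [pureState, vecMulVec_mulVec, hv]; simp
    rw [heq, sum_mulVec, dotProduct_sum] at h0
    simp only [smul_mulVec, dotProduct_smul, smul_eq_mul] at h0
    have hnn : ∀ j ∈ Finset.univ, 0 ≤ (p j : ℂ) * (star v ⬝ᵥ (tensor (σ j) *ᵥ v)) := fun j _ =>
      mul_nonneg (by exact_mod_cast hp j) ((hB j).dotProduct_mulVec_nonneg v)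
    have := (Finset.sum_eq_zero_iff_of_nonneg hnn).mp h0 i (Finset.mem_univ _)
    rcases mul_eq_zero.mp this with h | h
    · exact absurd h (by exact_mod_cast hi.ne')
    · exact h

/-- These are the quadratic Segre relations: exchanging coordinate `k` of the two row indices only
exchanges the `k`-th factors of the two products. -/
theorem tensor_swap (σ : Fin K → Matrix (Fin n) (Fin n) ℂ) (k : Fin K) (x y a : Fin K → Fin n) :
    tensor σ x a * tensor σ y a =
      tensor σ (Function.update x k (y k)) a * tensor σ (Function.update y k (x k)) a := by
  simp only [tensor, Matrix.of_apply, ← Finset.prod_mul_distrib]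
  refine Finset.prod_congr rfl fun j _ => ?_
  by_cases hj : j = k
  · subst hj; simp [mul_comm]
  · simp [hj]

theorem isEntangled_pureState {φ : (Fin K → Fin n) → ℂ} (hφ : ∑ x, ‖φ x‖ ^ 2 = 1) (k : Fin K)
    (x y : Fin K → Fin n)
    (h : pureState φ x x * pureState φ y x ≠
      pureState φ (Function.update x k (y k)) x * pureState φ (Function.update y k (x k)) x) :
    IsEntangled (pureState φ) := by
  refine ⟨isDensity_pureState hφ, fun hs => h ?_⟩
  obtain ⟨σ, hσ⟩ := exists_tensor_eq_of_isSeparable hφ hs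
  rw [hσ]
  exact tensor_swap σ k x y x

theorem isSeparable_pureState_tensorVec {ψ : Fin K → Fin n → ℂ}
    (hψ : ∀ k, ∑ i, ‖ψ k i‖ ^ 2 = 1) : IsSeparable (pureState (tensorVec ψ)) :=
  ⟨1, fun _ => 1, fun _ k => pureState (ψ k), by simp, by simp,
    fun _ k => isDensity_pureState (hψ k), by simp [tensor_pureState]⟩

end

/-! ### Null sets for Haar random vectors -/

section
variable {ι : Type} [Fintype ι] [DecidableEq ι]

/-- The translates of A along one real direction are uncountably many disjoint sets of equal volume,
and a σ-finite measure allows only countably many of positive measure. -/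
theorem volume_eq_zero_of_coord (x : ι) {A : Set (ι → ℂ)} (hA : MeasurableSet A)
    (h : ∀ z ∈ A, ∀ t : ℝ, t ≠ 0 → z + Pi.single x (t : ℂ) ∉ A) : volume A = 0 := by
  have hcount := Measure.countable_meas_pos_of_disjoint_iUnion (μ := (volume : Measure (ι → ℂ)))
    (As := fun t : ℝ => (fun z : ι → ℂ => z + Pi.single x (t : ℂ)) ⁻¹' A)
    (fun t => (measurable_id.add_const _) hA) (by
      intro s t hst
      refine Set.disjoint_left.mpr fun z hs ht => ?_
      refine h _ hs (t - s) (sub_ne_zero.mpr (Ne.symm hst)) ?_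
      have : z + Pi.single x (s : ℂ) + Pi.single x ((t - s : ℝ) : ℂ)
          = z + Pi.single x (t : ℂ) := by
        rw [add_assoc, ← Pi.single_add]
        push_cast
        rw [add_sub_cancel]
      rw [this]; exact ht)
  by_contra hne
  have : {t : ℝ | 0 < volume ((fun z : ι → ℂ => z + Pi.single x (t : ℂ)) ⁻¹' A)} = Set.univ := by
    refine Set.eq_univ_of_forall fun t => ?_
    simp only [Set.mem_ofPred_eq, measure_preimage_add_right]
    exact pos_iff_ne_zero.mpr hne
  rw [this] at hcount
  exact Set.not_countable_univ hcount

theorem volume_coord_eq_zero (x : ι) : volume {z : ι → ℂ | z x = 0} = 0 :=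
  volume_eq_zero_of_coord x (measurableSet_eq_fun (by fun_prop) (by fun_prop)) (by
    intro z hz t ht h
    simp only [Set.mem_ofPred_eq] at hz h
    simp [hz, ht] at h)

/-- Off the null set `z y = 0`, the equation determines `z x` from the other coordinates. -/
theorem volume_minor_eq_zero {x y u v : ι} (hxy : x ≠ y) (hxu : x ≠ u) (hxv : x ≠ v) :
    volume {z : ι → ℂ | z x * z y = z u * z v} = 0 := by
  have h1 : volume {z : ι → ℂ | z y ≠ 0 ∧ z x * z y = z u * z v} = 0 := by
    refine volume_eq_zero_of_coord x ?_ ?_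
    · exact (measurableSet_eq_fun (by fun_prop) (by fun_prop)).compl.inter
        (measurableSet_eq_fun (by fun_prop) (by fun_prop))
    · rintro z ⟨hy, hz⟩ t ht ⟨-, h⟩
      simp only [Pi.add_apply, Pi.single_eq_same, Pi.single_eq_of_ne hxy.symm,
        Pi.single_eq_of_ne hxu.symm, Pi.single_eq_of_ne hxv.symm, add_zero, add_mul, hz] at h
      have : (t : ℂ) * z y = 0 := by linear_combination h
      simp [ht, hy] at this
  refine measure_mono_null (t := {z : ι → ℂ | z y = 0} ∪
    {z : ι → ℂ | z y ≠ 0 ∧ z x * z y = z u * z v}) ?_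
    (measure_union_null (volume_coord_eq_zero y) h1)
  intro z hz
  by_cases hy : z y = 0
  · exact Or.inl hy
  · exact Or.inr ⟨hy, hz⟩

/-- Scale invariant Lebesgue null sets are null for Haar random unit vectors. -/
theorem haarVec_eq_zero_of_volume (o : ι) {S : Set (ι → ℂ)} (hS : MeasurableSet S)
    (hscale : ∀ (c : ℝ) (z : ι → ℂ), 0 < c → ((c : ℂ) • z ∈ S ↔ z ∈ S)) (h0 : volume S = 0) :
    haarVec o S = 0 := by
  -- The indicator of a scale invariant set is homogeneous of degree zero.
  have h := lintegral_gaussVec_of_homogeneous o 0 (f := S.indicator 1)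
    (measurable_one.indicator hS) (by
      intro c z hc
      have := hscale c z hc
      by_cases hz : z ∈ S
      · rw [Set.indicator_of_mem (this.mpr hz), Set.indicator_of_mem hz]; simp
      · rw [Set.indicator_of_notMem (mt this.mp hz), Set.indicator_of_notMem hz]; simp)
  rw [lintegral_indicator_one hS, lintegral_indicator_one hS,
    gaussVec_absolutelyContinuous h0] at h
  simpa using h.symm

end

/-! ### Almost sure entanglement, and completeness and soundness as two means -/

section
variable {K n : ℕ} [NeZero n]

omit [NeZero n] in
-- Column `x` of the projector is φ times the conjugate of `φ x`, so the relation is a quadratic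
-- minor of φ times the squared conjugate of `φ x`. The second coordinate `j` in which `x` and `y`
-- differ keeps the index `x` apart from `Function.update y k (x k)`.
theorem ae_haarVec_minor_ne (o : Fin K → Fin n) {x y : Fin K → Fin n} {k j : Fin K} (hjk : j ≠ k)
    (hk : x k ≠ y k) (hj : x j ≠ y j) :
    ∀ᵐ φ ∂(haarVec o), pureState φ x x * pureState φ y x ≠
      pureState φ (Function.update x k (y k)) x * pureState φ (Function.update y k (x k)) x := by
  have h1 : haarVec o {z | z x = 0} = 0 := by
    refine haarVec_eq_zero_of_volume o (measurableSet_eq_fun (by fun_prop) (by fun_prop)) ?_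
      (volume_coord_eq_zero x)
    intro c z hc
    simp [hc.ne']
  have h2 : haarVec o {z | z x * z y =
      z (Function.update x k (y k)) * z (Function.update y k (x k))} = 0 := by
    refine haarVec_eq_zero_of_volume o (measurableSet_eq_fun (by fun_prop) (by fun_prop)) ?_
      (volume_minor_eq_zero ?_ ?_ ?_)
    · intro c z hc
      have hc' : ((c : ℂ) * c) ≠ 0 := by simp [hc.ne']
      simp only [Set.mem_ofPred_eq, Pi.smul_apply, smul_eq_mul]
      constructor
      · intro h
        refine mul_left_cancel₀ hc' ?_
        linear_combination h
      · intro h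
        linear_combination (c : ℂ) * c * h
    · intro h; exact hk (congrFun h k)
    · intro h; have := congrFun h k; simp at this; exact hk this
    · intro h; have := congrFun h j; simp [hjk] at this; exact hj this
  have h1' : ∀ᵐ φ ∂(haarVec o), ¬ φ x = 0 := compl_mem_ae_iff.mpr h1
  have h2' : ∀ᵐ φ ∂(haarVec o), ¬ (φ x * φ y =
    φ (Function.update x k (y k)) * φ (Function.update y k (x k))) := compl_mem_ae_iff.mpr h2
  filter_upwards [h1', h2'] with φ hx hm heq
  refine hm ?_
  simp only [pureState_apply] at heq
  have hc : star (φ x) * star (φ x) ≠ 0 := by simp [hx]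
  refine mul_left_cancel₀ hc ?_
  linear_combination heq

/-- The set of all projectors onto product vectors. -/
def productStates (K n : ℕ) [NeZero n] : Set (Matrix (Fin K → Fin n) (Fin K → Fin n) ℂ) :=
  Set.range fun U : Fin K → Matrix.unitaryGroup (Fin n) ℂ =>
    pureState (tensorVec fun k => unitaryCol 0 (U k))

theorem isCompact_productStates : IsCompact (productStates K n) :=
  isCompact_range (continuous_pureState.comp (continuous_tensorVec.comp continuous_pi_unitaryCol))

theorem isSeparable_of_mem_productStates {ρ : Matrix (Fin K → Fin n) (Fin K → Fin n) ℂ}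
    (hρ : ρ ∈ productStates K n) : IsSeparable ρ := by
  obtain ⟨U, rfl⟩ := hρ
  exact isSeparable_pureState_tensorVec fun k => sum_normSq_unitaryCol 0 (U k)

theorem ae_haarProduct_mem_productStates :
    ∀ᵐ ρ ∂(haarProduct K n), ρ ∈ productStates K n := by
  have hm : MeasurableSet (productStates K n) := isCompact_productStates.isClosed.measurableSet
  rw [haarProduct_eq_map, productVec]
  refine (ae_map_iff continuous_pureState.measurable.aemeasurable hm).mpr ?_
  refine (ae_map_iff continuous_tensorVec.measurable.aemeasurable
    (continuous_pureState.measurable hm)).mpr ?_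
  rw [pi_haarVec_eq_map]
  refine (ae_map_iff continuous_pi_unitaryCol.measurable.aemeasurable
    (continuous_tensorVec.measurable (continuous_pureState.measurable hm))).mpr ?_
  exact Filter.Eventually.of_forall fun U => ⟨U, rfl⟩

theorem ae_haarPure_isEntangled (hK : 2 ≤ K) (hn : 2 ≤ n) :
    ∀ᵐ ρ ∂(haarPure (fun _ => 0 : Fin K → Fin n)), IsEntangled ρ := by
  set k : Fin K := ⟨0, by omega⟩
  set j : Fin K := ⟨1, by omega⟩
  set x : Fin K → Fin n := fun _ => ⟨0, by omega⟩
  set y : Fin K → Fin n := fun _ => ⟨1, by omega⟩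
  have hjk : j ≠ k := by simp [j, k]
  have hxy : ∀ i, x i ≠ y i := by intro i; simp [x, y]
  set R : Set (Matrix (Fin K → Fin n) (Fin K → Fin n) ℂ) :=
    Set.range fun U => pureState (unitaryCol (fun _ => 0 : Fin K → Fin n) U)
  have hR : MeasurableSet R := (isCompact_range
    (continuous_pureState.comp (continuous_unitaryCol _))).isClosed.measurableSet
  have h1 : ∀ᵐ ρ ∂(haarPure (fun _ => 0 : Fin K → Fin n)), ρ ∈ R := by
    rw [haarPure_eq_map, haarVec]
    refine (ae_map_iff continuous_pureState.measurable.aemeasurable hR).mpr ?_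
    refine (ae_map_iff (continuous_unitaryCol _).measurable.aemeasurable
      (continuous_pureState.measurable hR)).mpr ?_
    exact Filter.Eventually.of_forall fun U => ⟨U, rfl⟩
  have h2 : ∀ᵐ ρ ∂(haarPure (fun _ => 0 : Fin K → Fin n)), ρ x x * ρ y x ≠
      ρ (Function.update x k (y k)) x * ρ (Function.update y k (x k)) x := by
    rw [haarPure_eq_map]
    refine (ae_map_iff continuous_pureState.measurable.aemeasurable ?_).mpr
      (ae_haarVec_minor_ne _ hjk (hxy k) (hxy j))
    refine (isClosed_eq ?_ ?_).measurableSet.compl <;>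
      exact (continuous_apply_apply _ _).mul (continuous_apply_apply _ _)
  filter_upwards [h1, h2] with ρ hρ hm
  obtain ⟨U, rfl⟩ := hρ
  exact isEntangled_pureState (sum_normSq_unitaryCol _ U) k x y hm

theorem haarProduct_isEntangled_eq_zero : haarProduct K n {ρ | IsEntangled ρ} = 0 := by
  have h : ∀ᵐ ρ ∂(haarProduct K n), ¬ IsEntangled ρ := by
    filter_upwards [ae_haarProduct_mem_productStates] with ρ hρ hE
    exact hE.2 (isSeparable_of_mem_productStates hρ)
  simpa [ae_iff] using h

instance haarProduct_isProbabilityMeasure : IsProbabilityMeasure (haarProduct K n) := by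
  rw [haarProduct_eq_map]
  exact Measure.isProbabilityMeasure_map continuous_pureState.measurable.aemeasurable

theorem integral_haarProduct {f : Matrix (Fin K → Fin n) (Fin K → Fin n) ℂ → ℝ}
    (hf : Continuous f) :
    ∫ ρ, f ρ ∂(haarProduct K n) = ∫ ψ, f (pureState ψ) ∂(productVec K n) := by
  rw [haarProduct_eq_map]
  exact integral_map continuous_pureState.measurable.aemeasurable hf.aestronglyMeasurable

theorem integrable_haarPure {ι : Type} [Fintype ι] [DecidableEq ι] (o : ι) {f : Matrix ι ι ℂ → ℝ}
    (hf : Continuous f) : Integrable f (haarPure o) := by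
  rw [haarPure_eq_map, integrable_map_measure hf.aestronglyMeasurable
    continuous_pureState.measurable.aemeasurable]
  exact integrable_haarVec o (hf.comp continuous_pureState)

theorem integrable_haarProduct {f : Matrix (Fin K → Fin n) (Fin K → Fin n) ℂ → ℝ}
    (hf : Continuous f) : Integrable f (haarProduct K n) := by
  rw [haarProduct_eq_map, integrable_map_measure hf.aestronglyMeasurable
    continuous_pureState.measurable.aemeasurable]
  exact integrable_productVec (hf.comp continuous_pureState)

theorem Protocol.completeness_eq {T : ℕ} (P : Protocol (Fin K → Fin n) T) :
    P.completeness = (P.meanHaar + P.meanProduct) / 2 := by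
  have hc := P.continuous_probNeg
  unfold Protocol.completeness stateLaw
  rw [integral_add_measure ((integrable_haarPure _ hc).smul_measure (by simp))
    ((integrable_haarProduct hc).smul_measure (by simp)), integral_smul_measure,
    integral_smul_measure, integral_haarPure _ hc, integral_haarProduct hc]
  simp only [ENNReal.toReal_inv, ENNReal.toReal_ofNat, smul_eq_mul]
  unfold Protocol.meanHaar Protocol.meanProduct
  ring

/-- The set of entangled states has full measure for one component of the law and measure zero for
the other, so its measurability is not needed. -/
theorem Protocol.soundness_eq (hK : 2 ≤ K) (hn : 2 ≤ n) {T : ℕ}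
    (P : Protocol (Fin K → Fin n) T) :
    P.soundness = P.meanHaar / 2 / P.completeness := by
  have hc := P.continuous_probNeg
  unfold Protocol.soundness
  congr 1
  unfold stateLaw
  rw [Measure.restrict_add, Measure.restrict_smul, Measure.restrict_smul,
    Measure.restrict_eq_self_of_ae_mem (s := {ρ | IsEntangled ρ}) (ae_haarPure_isEntangled hK hn),
    Measure.restrict_eq_zero.mpr haarProduct_isEntangled_eq_zero, smul_zero, add_zero,
    integral_smul_measure, integral_haarPure _ hc]
  simp only [ENNReal.toReal_inv, ENNReal.toReal_ofNat, smul_eq_mul]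
  unfold Protocol.meanHaar
  ring

/-- The prescribed completeness and soundness determine the two mean acceptance probabilities. -/
theorem Protocol.completeness_soundness_iff (hK : 2 ≤ K) (hn : 2 ≤ n) {T : ℕ}
    (P : Protocol (Fin K → Fin n) T) :
    (P.completeness = 1 / 4 ∧ P.soundness = 5 / 6) ↔
      (P.meanHaar = 5 / 12 ∧ P.meanProduct = 1 / 12) := by
  rw [P.soundness_eq hK hn]
  have h := P.completeness_eq
  constructor
  · rintro ⟨h1, h2⟩
    rw [h1] at h2 h
    constructor <;> linarith
  · rintro ⟨h1, h2⟩
    rw [h1, h2] at h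
    rw [h, h1]
    norm_num

end

/-! ### Building protocols -/

section
variable {ι : Type} [Fintype ι] [DecidableEq ι]

/-- The POVM that ignores the state and draws outcome `i` with probability `w i`. -/
def scalarPOVM {m : ℕ} (w : Fin m → ℝ) (hw : ∀ i, 0 ≤ w i) (hsum : ∑ i, w i = 1) : POVM ι m where
  elem i := (w i : ℂ) • 1
  posSemidef i := PosSemidef.one.smul (by exact_mod_cast hw i)
  sum_eq_one := by
    rw [← Finset.sum_smul, ← Complex.ofReal_sum, hsum, Complex.ofReal_one, one_smul]

theorem scalarPOVM_trace {m : ℕ} (w : Fin m → ℝ) (hw : ∀ i, 0 ≤ w i) (hsum : ∑ i, w i = 1)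
    {ρ : Matrix ι ι ℂ} (hρ : ρ.trace = 1) (i : Fin m) :
    (((scalarPOVM (ι := ι) w hw hsum).elem i * ρ).trace).re = w i := by
  simp [scalarPOVM, hρ]

/-- The nonadaptive protocol that measures `M` on every copy and computes `f` from the outcomes. -/
def sampleProtocol {m : ℕ} (M : POVM ι m) : (T : ℕ) → ((Fin T → Fin m) → ℝ) → Protocol ι T
  | 0, f => .leaf (f Fin.elim0)
  | T + 1, f => .node M fun i => sampleProtocol M T fun x => f (Fin.cons i x)

/-- The mean of `g` over `T` independent samples from the weights `p`. -/
def sampleMean {m : ℕ} (p : Fin m → ℝ) {T : ℕ} (g : (Fin T → Fin m) → ℝ) : ℝ :=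
  ∑ x, (∏ t, p (x t)) * g x

theorem sampleProtocol_leafMean {m : ℕ} (M : POVM ι m) (φ : ℝ → ℝ) (ρ : Matrix ι ι ℂ) (T : ℕ)
    (f : (Fin T → Fin m) → ℝ) :
    (sampleProtocol M T f).leafMean φ ρ
      = sampleMean (fun i => ((M.elem i * ρ).trace).re) fun x => φ (f x) := by
  induction T with
  | zero =>
    simp only [sampleProtocol, Protocol.leafMean, sampleMean, Finset.univ_eq_empty,
      Finset.prod_empty, one_mul, Fintype.sum_unique]
    congr 2
  | succ T ih =>
    simp only [sampleProtocol, Protocol.leafMean, ih, sampleMean]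
    rw [sum_consEquiv]
    refine Finset.sum_congr rfl fun i _ => ?_
    rw [Finset.mul_sum]
    refine Finset.sum_congr rfl fun x _ => ?_
    rw [Fin.prod_univ_succ]
    simp only [Fin.cons_zero, Fin.cons_succ]
    ring

theorem sampleProtocol_probNeg {m : ℕ} (M : POVM ι m) (ρ : Matrix ι ι ℂ) (T : ℕ)
    (f : (Fin T → Fin m) → ℝ) :
    (sampleProtocol M T f).probNeg ρ
      = sampleMean (fun i => ((M.elem i * ρ).trace).re) fun x => negInd (f x) := by
  rw [Protocol.probNeg_eq_leafMean, sampleProtocol_leafMean]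

/-- The protocol with constant value `v`. -/
def constProtocol (ι : Type) [Fintype ι] [DecidableEq ι] (v : ℝ) (T : ℕ) : Protocol ι T :=
  sampleProtocol (m := 1) (scalarPOVM (fun _ => 1) (by simp) (by simp)) T fun _ => v

theorem constProtocol_probNeg (v : ℝ) (T : ℕ) {ρ : Matrix ι ι ℂ} (hρ : ρ.trace = 1) :
    (constProtocol ι v T).probNeg ρ = negInd v := by
  rw [constProtocol, sampleProtocol_probNeg]
  simp [scalarPOVM_trace _ _ _ hρ, sampleMean]

/-- Run `P` with probability `w 0`, answer "entangled" with probability `w 1`. -/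
def mixProtocol {T : ℕ} (P : Protocol ι T) (w : Fin 3 → ℝ) (hw : ∀ i, 0 ≤ w i)
    (hsum : ∑ i, w i = 1) : Protocol ι (T + 1) :=
  .node (scalarPOVM w hw hsum) ![P, constProtocol ι (-1) T, constProtocol ι 1 T]

theorem mixProtocol_probNeg {T : ℕ} (P : Protocol ι T) (w : Fin 3 → ℝ) (hw : ∀ i, 0 ≤ w i)
    (hsum : ∑ i, w i = 1) {ρ : Matrix ι ι ℂ} (hρ : ρ.trace = 1) :
    (mixProtocol P w hw hsum).probNeg ρ = w 0 * P.probNeg ρ + w 1 := by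
  simp only [mixProtocol, Protocol.probNeg, scalarPOVM_trace w hw hsum hρ, Fin.sum_univ_three]
  simp [constProtocol_probNeg _ _ hρ, negInd]

end

/-- A protocol with enough distinguishing power yields, with one more copy, one with the exact
acceptance probabilities. -/
theorem exists_exact_protocol {K n : ℕ} [NeZero n] {T : ℕ} (P : Protocol (Fin K → Fin n) T)
    (hlt : P.meanProduct < P.meanHaar) (h1 : 5 * P.meanProduct ≤ P.meanHaar)
    (h2 : 4 + 7 * P.meanProduct ≤ 11 * P.meanHaar) :
    ∃ Q : Protocol (Fin K → Fin n) (T + 1), Q.meanHaar = 5 / 12 ∧ Q.meanProduct = 1 / 12 := by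
  set a := P.meanHaar with ha
  set b := P.meanProduct with hb
  have hd : 0 < a - b := sub_pos.mpr hlt
  -- The affine map t ↦ u t + (5/12 - u a) must send a to 5/12 and b to 1/12, so its slope is
  -- (1/3)/(a-b). The hypotheses `h1` and `h2` say precisely that the weights of the two constant
  -- answers are nonnegative.
  set u := 1 / (3 * (a - b)) with hu
  have hu0 : 0 ≤ u := by positivity
  have hua : u * (a - b) = 1 / 3 := by rw [hu]; field_simp
  set w : Fin 3 → ℝ := ![u, 5 / 12 - u * a, 7 / 12 - u * (1 - a)] with hw
  have hw1 : 0 ≤ 5 / 12 - u * a := by nlinarith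
  have hw2 : 0 ≤ 7 / 12 - u * (1 - a) := by nlinarith
  have hwn : ∀ i, 0 ≤ w i := by
    intro i; fin_cases i
    · exact hu0
    · exact hw1
    · exact hw2
  have hws : ∑ i, w i = 1 := by
    rw [Fin.sum_univ_three]; simp only [hw, cons_val_zero, cons_val_one, cons_val]; ring
  have hmean : ∀ (ν : Measure ((Fin K → Fin n) → ℂ)) [IsProbabilityMeasure ν],
      (∀ f : ((Fin K → Fin n) → ℂ) → ℝ, Continuous f → Integrable f ν) →
      (∀ᵐ ψ ∂ν, ∑ i, ‖ψ i‖ ^ 2 = 1) →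
      ∫ ψ, (mixProtocol P w hwn hws).probNeg (pureState ψ) ∂ν
        = w 0 * ∫ ψ, P.probNeg (pureState ψ) ∂ν + w 1 := by
    intro ν _ hint hnorm
    have hae : ∀ᵐ ψ ∂ν, (mixProtocol P w hwn hws).probNeg (pureState ψ)
        = w 0 * P.probNeg (pureState ψ) + w 1 := by
      filter_upwards [hnorm] with ψ hψ
      exact mixProtocol_probNeg P w hwn hws (by rw [trace_pureState, hψ]; simp)
    have hi : Integrable (fun ψ => w 0 * P.probNeg (pureState ψ)) ν :=
      (hint _ (P.continuous_probNeg.comp continuous_pureState)).const_mul _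
    rw [integral_congr_ae hae, integral_add hi (integrable_const _), integral_const_mul]
    simp
  refine ⟨mixProtocol P w hwn hws, ?_, ?_⟩
  · unfold Protocol.meanHaar
    rw [hmean _ (fun f hf => integrable_haarVec _ hf) (ae_haarVec_sum_normSq _)]
    change u * a + (5 / 12 - u * a) = _
    ring
  · unfold Protocol.meanProduct
    rw [hmean _ (fun f hf => integrable_productVec hf) ae_productVec_sum_normSq]
    change u * b + (5 / 12 - u * a) = _
    linarith

/-! ### Independent samples -/

section
variable {m T : ℕ} {p : Fin m → ℝ}

theorem sampleMean_prod (g : Fin T → Fin m → ℝ) :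
    sampleMean p (fun x => ∏ t, g t (x t)) = ∏ t, ∑ i, p i * g t i := by
  unfold sampleMean
  rw [Finset.prod_univ_sum, Fintype.piFinset_univ]
  exact Finset.sum_congr rfl fun x _ => by rw [Finset.prod_mul_distrib]

theorem sampleMean_one (hp : ∑ i, p i = 1) : sampleMean p (fun _ : Fin T → Fin m => 1) = 1 := by
  have := sampleMean_prod (p := p) (T := T) fun _ _ => 1
  simpa [hp] using this

theorem sampleMean_add (f g : (Fin T → Fin m) → ℝ) :
    sampleMean p (fun x => f x + g x) = sampleMean p f + sampleMean p g := by
  simp [sampleMean, mul_add, Finset.sum_add_distrib]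

theorem sampleMean_mul_left (c : ℝ) (f : (Fin T → Fin m) → ℝ) :
    sampleMean p (fun x => c * f x) = c * sampleMean p f := by
  simp only [sampleMean, Finset.mul_sum]
  exact Finset.sum_congr rfl fun x _ => by ring

theorem sampleMean_sum {α : Type*} (S : Finset α) (f : α → (Fin T → Fin m) → ℝ) :
    sampleMean p (fun x => ∑ a ∈ S, f a x) = ∑ a ∈ S, sampleMean p (f a) := by
  simp only [sampleMean, Finset.mul_sum]
  exact Finset.sum_comm

theorem sampleMean_mono (hp : ∀ i, 0 ≤ p i) {f g : (Fin T → Fin m) → ℝ} (h : ∀ x, f x ≤ g x) :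
    sampleMean p f ≤ sampleMean p g :=
  Finset.sum_le_sum fun x _ =>
    mul_le_mul_of_nonneg_left (h x) (Finset.prod_nonneg fun _ _ => hp _)

theorem sampleMean_eval (hp : ∑ i, p i = 1) (a : Fin T) (u : Fin m → ℝ) :
    sampleMean p (fun x => u (x a)) = ∑ i, p i * u i := by
  have h := sampleMean_prod (p := p) (T := T) fun t i => if t = a then u i else 1
  simp only [Finset.prod_ite_eq', Finset.mem_univ, if_true] at h
  rw [h, Finset.prod_eq_single a]
  · simp
  · intro b _ hb; simp [hb, hp]
  · simp

theorem sampleMean_eval_mul_eval (hp : ∑ i, p i = 1) {a b : Fin T} (hab : a ≠ b)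
    (u v : Fin m → ℝ) :
    sampleMean p (fun x => u (x a) * v (x b)) = (∑ i, p i * u i) * ∑ i, p i * v i := by
  have h := sampleMean_prod (p := p) (T := T) fun t i =>
    (if t = a then u i else 1) * (if t = b then v i else 1)
  simp only [Finset.prod_mul_distrib, Finset.prod_ite_eq', Finset.mem_univ, if_true] at h
  rw [h, ← Finset.mul_prod_erase _ _ (Finset.mem_univ a),
    ← Finset.mul_prod_erase _ _ (Finset.mem_erase.mpr ⟨hab.symm, Finset.mem_univ b⟩),
    Finset.prod_eq_one]
  · simp [hab, hab.symm]
  · intro t ht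
    simp only [Finset.mem_erase] at ht
    simp [ht.1, ht.2.1, hp]

/-- First moment of a linear statistic. -/
theorem sampleMean_linear (hp : ∑ i, p i = 1) (u : Fin m → ℝ) :
    sampleMean p (fun x : Fin T → Fin m => ∑ a, u (x a)) = T * ∑ i, p i * u i := by
  rw [sampleMean_sum]
  simp [sampleMean_eval hp]

/-- Second moments of linear statistics. -/
theorem sampleMean_linear_mul_linear (hp : ∑ i, p i = 1) (u v : Fin m → ℝ) :
    sampleMean p (fun x : Fin T → Fin m => (∑ a, u (x a)) * ∑ b, v (x b))
      = T * (T - 1) * ((∑ i, p i * u i) * ∑ i, p i * v i) + T * ∑ i, p i * (u i * v i) := by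
  have h0 : (fun x : Fin T → Fin m => (∑ a, u (x a)) * ∑ b, v (x b))
      = fun x => ∑ a, ∑ b, u (x a) * v (x b) := funext fun x => Finset.sum_mul_sum ..
  rw [h0, sampleMean_sum]
  simp only [sampleMean_sum]
  have h : ∀ a b : Fin T, sampleMean p (fun x => u (x a) * v (x b))
      = (∑ i, p i * u i) * (∑ i, p i * v i) + if a = b then
        (∑ i, p i * (u i * v i)) - (∑ i, p i * u i) * (∑ i, p i * v i) else 0 := by
    intro a b
    split_ifs with hab
    · subst hab
      rw [sampleMean_eval hp a fun i => u i * v i]; ring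
    · rw [sampleMean_eval_mul_eval hp hab, add_zero]
  simp only [h, Finset.sum_add_distrib, Finset.sum_ite_eq, Finset.mem_univ, if_true,
    Finset.sum_const, Finset.card_univ, Fintype.card_fin, nsmul_eq_mul]
  ring

/-- The number of samples with value `i`. -/
def count (x : Fin T → Fin m) (i : Fin m) : ℝ := ∑ a, if x a = i then 1 else 0

theorem sampleMean_count (hp : ∑ i, p i = 1) (i : Fin m) :
    sampleMean p (fun x : Fin T → Fin m => count x i) = T * p i := by
  unfold count
  rw [sampleMean_linear hp fun j => if j = i then 1 else 0]
  simp

theorem sampleMean_count_mul_count (hp : ∑ i, p i = 1) (i j : Fin m) :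
    sampleMean p (fun x : Fin T → Fin m => count x i * count x j)
      = T * (T - 1) * (p i * p j) + if i = j then T * p i else 0 := by
  unfold count
  rw [sampleMean_linear_mul_linear hp (fun l => if l = i then 1 else 0)
    fun l => if l = j then 1 else 0]
  by_cases hij : i = j
  · subst hij; simp
  · have : ∀ l, (if l = i then (1 : ℝ) else 0) * (if l = j then 1 else 0) = 0 := by
      intro l
      by_cases h : l = i
      · subst h; simp [hij]
      · simp [h]
    simp [this, hij]

end

/-! ### Tomography: distinguishing in a fixed dimension -/

section
variable {ι : Type} [Fintype ι] [DecidableEq ι]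

/-- The outcome distribution of the measurement `M` in the state `ρ`. -/
noncomputable def POVM.prob {m : ℕ} (M : POVM ι m) (ρ : Matrix ι ι ℂ) : Fin m → ℝ :=
  fun i => ((M.elem i * ρ).trace).re

theorem POVM.continuous_prob {m : ℕ} (M : POVM ι m) : Continuous M.prob :=
  continuous_pi fun _ =>
    Complex.continuous_re.comp (continuous_const.mul continuous_id).matrix_trace

theorem POVM.sum_prob {m : ℕ} (M : POVM ι m) {ρ : Matrix ι ι ℂ} (hρ : ρ.trace = 1) :
    ∑ i, M.prob ρ i = 1 := by
  unfold POVM.prob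
  rw [M.sum_trace_mul, hρ, Complex.one_re]

theorem POVM.prob_pureState_nonneg {m : ℕ} (M : POVM ι m) (ψ : ι → ℂ) (i : Fin m) :
    0 ≤ M.prob (pureState ψ) i := born_nonneg (M.posSemidef i) ψ

/-- The vector `e_x + i^k e_y`. -/
noncomputable def tomoVec (x y : ι) (k : Fin 4) : ι → ℂ :=
  Pi.single x 1 + (Complex.I ^ (k : ℕ)) • Pi.single y 1

/-- The cross terms cancel because the fourth roots of unity sum to zero; each pair `(x, y)` leaves
four times the diagonal projections at `x` and at `y`. -/
theorem sum_pureState_tomoVec :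
    ∑ j : (ι × ι) × Fin 4, pureState (tomoVec j.1.1 j.1.2 j.2)
      = ((8 * Fintype.card ι : ℝ) : ℂ) • (1 : Matrix ι ι ℂ) := by
  ext a b
  rw [Matrix.sum_apply, Fintype.sum_prod_type, Fintype.sum_prod_type]
  have h : ∀ x y : ι, ∑ k : Fin 4, pureState (tomoVec x y k) a b
      = 4 * ((if a = x then 1 else 0) * (if b = x then 1 else 0))
        + 4 * ((if a = y then 1 else 0) * (if b = y then 1 else 0)) := by
    intro x y
    simp only [Fin.sum_univ_four, pureState_apply, tomoVec, Pi.add_apply, Pi.smul_apply,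
      Pi.single_apply, smul_eq_mul, star_add, star_mul', apply_ite star, star_one, star_zero,
      star_pow, Complex.star_def, Complex.conj_I]
    simp only [Fin.isValue, Fin.val_zero, Fin.val_one, Fin.val_two, pow_zero, pow_one, one_mul]
    have h3 : ((3 : Fin 4) : ℕ) = 3 := rfl
    rw [h3]
    simp only [pow_succ, pow_zero, one_mul, neg_mul, mul_neg, Complex.I_mul_I, neg_neg]
    linear_combination (-(2 : ℂ)) * ((if a = y then 1 else 0) * (if b = y then 1 else 0))
      * Complex.I_mul_I
  simp only [h, Finset.sum_add_distrib]
  by_cases hab : a = b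
  · subst hab
    simp
    ring
  · have : ∀ x, (if a = x then (1 : ℂ) else 0) * (if b = x then 1 else 0) = 0 := by
      intro x
      by_cases hx : a = x
      · subst hx; simp [Ne.symm hab]
      · simp [hx]
    simp [this, hab]

omit [DecidableEq ι] in
theorem trace_pureState_mul (v : ι → ℂ) (ρ : Matrix ι ι ℂ) :
    (pureState v * ρ).trace = star v ⬝ᵥ (ρ *ᵥ v) := by
  rw [trace_mul_comm, trace_mul_pureState]

/-- Polarisation: the discrete Fourier sum over `k` retains only the term of phase `I ^ k`. -/
theorem sum_tomoVec_eq (ρ : Matrix ι ι ℂ) (x y : ι) :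
    ∑ k : Fin 4, (-Complex.I) ^ (k : ℕ) * (pureState (tomoVec x y k) * ρ).trace
      = 4 * ρ x y := by
  have h : ∀ k : Fin 4, (pureState (tomoVec x y k) * ρ).trace
      = ρ x x + ρ y y * (Complex.I * (-Complex.I)) ^ (k : ℕ) + Complex.I ^ (k : ℕ) * ρ x y
        + (-Complex.I) ^ (k : ℕ) * ρ y x := by
    intro k
    rw [trace_pureState_mul, tomoVec, mulVec_add, mulVec_smul, mulVec_single_one,
      mulVec_single_one, star_add, star_smul, add_dotProduct, smul_dotProduct, dotProduct_add,
      dotProduct_add, dotProduct_smul, dotProduct_smul]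
    have hs : ∀ z : ι, star (Pi.single z (1 : ℂ)) = (Pi.single z 1 : ι → ℂ) := by
      intro z; funext i; by_cases hi : i = z
      · subst hi; simp
      · simp [hi]
    simp only [hs, single_one_dotProduct, smul_eq_mul, star_pow, Complex.star_def, Complex.conj_I,
      Matrix.col_apply, mul_pow]
    ring
  simp only [h, Fin.sum_univ_four]
  simp only [Fin.isValue, Fin.val_zero, Fin.val_one, Fin.val_two, pow_zero, pow_one, one_mul]
  have h3 : ((3 : Fin 4) : ℕ) = 3 := rfl
  rw [h3]
  have hI : Complex.I ^ 2 = -1 := Complex.I_sq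
  have hI3 : Complex.I ^ 3 = -Complex.I := by rw [pow_succ, hI]; ring
  have hn2 : (-Complex.I) ^ 2 = -1 := by rw [neg_sq, hI]
  have hn3 : (-Complex.I) ^ 3 = Complex.I := by rw [pow_succ, hn2]; ring
  rw [mul_neg, Complex.I_mul_I, neg_neg, hI, hI3, hn2, hn3]
  linear_combination (-2 * (ρ x y - ρ y x)) * hI

/-- The informationally complete measurement. -/
noncomputable def tomoPOVM (ι : Type) [Fintype ι] [DecidableEq ι] [Nonempty ι] :
    POVM ι (Fintype.card ((ι × ι) × Fin 4)) where
  elem i := (((8 * Fintype.card ι : ℝ)⁻¹ : ℝ) : ℂ) • pureState (tomoVec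
    ((Fintype.equivFin _).symm i).1.1 ((Fintype.equivFin _).symm i).1.2
    ((Fintype.equivFin _).symm i).2)
  posSemidef i := (pureState_posSemidef _).smul (by
    have : (0 : ℝ) ≤ (8 * Fintype.card ι : ℝ)⁻¹ := by positivity
    exact_mod_cast this)
  sum_eq_one := by
    rw [← Finset.smul_sum, Fintype.sum_equiv (Fintype.equivFin _).symm _
      (fun j : (ι × ι) × Fin 4 => pureState (tomoVec j.1.1 j.1.2 j.2)) fun _ => rfl,
      sum_pureState_tomoVec, smul_smul, ← Complex.ofReal_mul, inv_mul_cancel₀, Complex.ofReal_one,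
      one_smul]
    have : (0 : ℝ) < Fintype.card ι := by exact_mod_cast Fintype.card_pos
    positivity

theorem tomoPOVM_injective [Nonempty ι] {ρ ρ' : Matrix ι ι ℂ} (hρ : ρ.PosSemidef)
    (hρ' : ρ'.PosSemidef) (h : (tomoPOVM ι).prob ρ = (tomoPOVM ι).prob ρ') : ρ = ρ' := by
  have hpos : (0 : ℝ) < (8 * Fintype.card ι : ℝ)⁻¹ := by
    have : (0 : ℝ) < Fintype.card ι := by exact_mod_cast Fintype.card_pos
    positivity
  have key : ∀ x y k, (pureState (tomoVec x y k) * ρ).trace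
      = (pureState (tomoVec x y k) * ρ').trace := by
    intro x y k
    have h1 := congrFun h (Fintype.equivFin _ ((x, y), k))
    simp only [POVM.prob, tomoPOVM, Equiv.symm_apply_apply, smul_mul_assoc, trace_smul,
      smul_eq_mul, Complex.re_ofReal_mul] at h1
    have h2 := mul_left_cancel₀ hpos.ne' h1
    -- `POVM.prob` keeps real parts only; positivity makes the imaginary parts vanish.
    have him : ∀ {σ : Matrix ι ι ℂ}, σ.PosSemidef →
        (pureState (tomoVec x y k) * σ).trace.im = 0 := by
      intro σ hσ
      rw [trace_pureState_mul]
      exact (Complex.nonneg_iff.mp (hσ.dotProduct_mulVec_nonneg _)).2.symm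
    exact Complex.ext h2 (by rw [him hρ, him hρ'])
  ext x y
  have h1 := sum_tomoVec_eq ρ x y
  have h2 := sum_tomoVec_eq ρ' x y
  simp only [key] at h1
  rw [h1] at h2
  exact mul_left_cancel₀ (by norm_num) h2

end

/-! ### Concentration of empirical frequencies and the tomography protocol -/

/-- Empirical frequencies. -/
noncomputable def empirical {m T : ℕ} (x : Fin T → Fin m) : Fin m → ℝ := fun i => count x i / T

/-- Chebyshev's inequality for empirical frequencies. -/
theorem sampleMean_empirical {m T : ℕ} (hT : 0 < T) {p : Fin m → ℝ} (hp : ∑ i, p i = 1) :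
    sampleMean p (fun x : Fin T → Fin m => ∑ i, (empirical x i - p i) ^ 2) ≤ 1 / T := by
  have hT' : (T : ℝ) ≠ 0 := by positivity
  rw [sampleMean_sum]
  have h : ∀ i, sampleMean p (fun x : Fin T → Fin m => (empirical x i - p i) ^ 2)
      = (p i - p i ^ 2) / T := by
    intro i
    have h1 : (fun x : Fin T → Fin m => (empirical x i - p i) ^ 2) = fun x =>
        (1 / (T : ℝ) ^ 2) * (count x i * count x i) +
          ((-2 * p i / T) * count x i + (p i ^ 2) * 1) := by
      funext x
      unfold empirical
      field_simp
      ring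
    rw [h1, sampleMean_add, sampleMean_add, sampleMean_mul_left, sampleMean_mul_left,
      sampleMean_mul_left, sampleMean_count_mul_count hp, sampleMean_count hp, sampleMean_one hp]
    simp only [if_true]
    field_simp
    ring
  simp only [h]
  rw [← Finset.sum_div, Finset.sum_sub_distrib, hp]
  have : 0 ≤ ∑ i, p i ^ 2 := by positivity
  gcongr
  linarith

theorem ind_le_of_dist {m : ℕ} {p q : Fin m → ℝ} {δ : ℝ} (hδ : 0 < δ) (h : δ ≤ dist q p) :
    1 ≤ δ⁻¹ ^ 2 * ∑ i, (q i - p i) ^ 2 := by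
  have hne : ∃ i, δ ≤ dist (q i) (p i) := by
    by_contra hcon
    push Not at hcon
    exact absurd ((dist_pi_lt_iff hδ).mpr hcon) (not_lt.mpr h)
  obtain ⟨i, hi⟩ := hne
  have h1 : δ ^ 2 ≤ ∑ i, (q i - p i) ^ 2 := by
    calc δ ^ 2 ≤ (q i - p i) ^ 2 := by
          rw [← sq_abs (q i - p i), ← Real.dist_eq]
          exact pow_le_pow_left₀ hδ.le hi 2
      _ ≤ _ := Finset.single_le_sum (f := fun i => (q i - p i) ^ 2) (fun _ _ => sq_nonneg _)
          (Finset.mem_univ i)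
  calc (1 : ℝ) = δ⁻¹ ^ 2 * δ ^ 2 := by field_simp
    _ ≤ _ := mul_le_mul_of_nonneg_left h1 (by positivity)

theorem sampleMean_dist_bound {m T : ℕ} (hT : 0 < T) {p : Fin m → ℝ} (hp0 : ∀ i, 0 ≤ p i)
    (hp : ∑ i, p i = 1) {δ : ℝ} (hδ : 0 < δ) {g : (Fin T → Fin m) → ℝ}
    (hg : ∀ x, g x ≤ 1) (hg' : ∀ x, dist (empirical x) p < δ → g x ≤ 0) :
    sampleMean p g ≤ δ⁻¹ ^ 2 * (1 / T) := by
  calc sampleMean p g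
      ≤ sampleMean p (fun x : Fin T → Fin m => δ⁻¹ ^ 2 * ∑ i, (empirical x i - p i) ^ 2) := by
        refine sampleMean_mono hp0 fun x => ?_
        by_cases h : dist (empirical x) p < δ
        · exact (hg' x h).trans (by positivity)
        · exact (hg x).trans (ind_le_of_dist hδ (not_lt.mp h))
    _ = δ⁻¹ ^ 2 * sampleMean p (fun x : Fin T → Fin m => ∑ i, (empirical x i - p i) ^ 2) :=
        sampleMean_mul_left _ _
    _ ≤ _ := mul_le_mul_of_nonneg_left (sampleMean_empirical hT hp) (by positivity)

section
variable {K n : ℕ} [NeZero n]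

/-- The outcome distributions of product states form a compact set Q. The measurement is injective
on states, so a Haar state almost surely has positive distance to Q, and empirical frequencies
eventually detect it. Nothing is said about how T grows with n, so this serves only finitely many
dimensions. -/
theorem exists_tomography_protocol (hK : 2 ≤ K) (hn : 2 ≤ n) :
    ∃ (T : ℕ) (P : Protocol (Fin K → Fin n) T),
      99 / 100 ≤ P.meanHaar ∧ P.meanProduct ≤ 1 / 100 := by
  set M := tomoPOVM (Fin K → Fin n) with hM
  set Q := M.prob '' productStates K n with hQ
  have hQc : IsCompact Q := isCompact_productStates.image M.continuous_prob
  have hQne : Q.Nonempty := (Set.range_nonempty _).image _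
  set h : ((Fin K → Fin n) → ℂ) → ℝ := fun ψ => Metric.infDist (M.prob (pureState ψ)) Q with hh
  have hcont : Continuous h :=
    (Metric.continuous_infDist_pt Q).comp (M.continuous_prob.comp continuous_pureState)
  set ν := haarVec (fun _ => 0 : Fin K → Fin n) with hν
  have hpos : ∀ᵐ ψ ∂ν, 0 < h ψ := by
    have hE := ae_haarPure_isEntangled hK hn
    rw [haarPure_eq_map] at hE
    filter_upwards [ae_of_ae_map continuous_pureState.measurable.aemeasurable hE] with ψ hψ
    refine lt_of_le_of_ne Metric.infDist_nonneg fun h0 => ?_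
    obtain ⟨ρ, hρ, heq⟩ := (hQc.isClosed.mem_iff_infDist_zero hQne).mpr h0.symm
    have hsep := isSeparable_of_mem_productStates hρ
    have hPSD : ρ.PosSemidef := by
      obtain ⟨U, rfl⟩ := hρ
      exact pureState_posSemidef _
    rw [tomoPOVM_injective hPSD (pureState_posSemidef ψ) heq] at hsep
    exact hψ.2 hsep
  -- Continuity from above: the events of distance at most 2/(k+1) decrease to a null set. The
  -- factor 2 leaves a margin δ for the sampling error around the acceptance threshold δ.
  obtain ⟨δ, hδ, hδS⟩ : ∃ δ : ℝ, 0 < δ ∧ ν.real {ψ | h ψ ≤ 2 * δ} ≤ 1 / 200 := by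
    have htend := tendsto_measure_iInter_atTop (μ := ν)
      (s := fun k : ℕ => {ψ | h ψ ≤ 2 * (1 / ((k : ℝ) + 1))})
      (fun k => (measurableSet_le hcont.measurable measurable_const).nullMeasurableSet)
      (fun k l hkl ψ hψ => by
        have : 1 / ((l : ℝ) + 1) ≤ 1 / ((k : ℝ) + 1) := Nat.one_div_le_one_div hkl
        have h2 : h ψ ≤ 2 * (1 / ((l : ℝ) + 1)) := hψ
        exact h2.trans (by linarith))
      ⟨0, measure_ne_top _ _⟩
    have hnull : ν (⋂ k : ℕ, {ψ | h ψ ≤ 2 * (1 / ((k : ℝ) + 1))}) = 0 := by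
      refine measure_mono_null ?_ (compl_mem_ae_iff.mp (by
        filter_upwards [hpos] with ψ hψ using (show ψ ∈ {ψ | h ψ ≤ 0}ᶜ from not_le.mpr hψ)))
      intro ψ hψ
      change h ψ ≤ 0
      refine le_of_forall_pos_le_add fun ε hε => ?_
      obtain ⟨k, hk⟩ := exists_nat_one_div_lt (half_pos hε)
      have := Set.mem_iInter.mp hψ k
      have h2 : h ψ ≤ 2 * (1 / ((k : ℝ) + 1)) := this
      linarith
    rw [hnull] at htend
    have hev := htend.eventually (ge_mem_nhds (show (0 : ℝ≥0∞) < ENNReal.ofReal (1 / 200) by simp))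
    obtain ⟨k, hk⟩ := hev.exists
    refine ⟨1 / ((k : ℝ) + 1), by positivity, ?_⟩
    exact ENNReal.toReal_le_of_le_ofReal (by norm_num) hk
  obtain ⟨T, hT⟩ := exists_nat_gt (200 * δ⁻¹ ^ 2)
  have hT0 : (0 : ℝ) < T := lt_of_le_of_lt (by positivity) hT
  have hTpos : 0 < T := by exact_mod_cast hT0
  have hbound : δ⁻¹ ^ 2 * (1 / (T : ℝ)) ≤ 1 / 200 := by
    rw [mul_one_div, div_le_iff₀ hT0]; linarith
  set f : (Fin T → Fin _) → ℝ := fun x => δ - Metric.infDist (empirical x) Q with hf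
  set P := sampleProtocol M T f with hP
  have hprob : ∀ ψ, P.probNeg (pureState ψ)
      = sampleMean (M.prob (pureState ψ)) fun x => negInd (f x) := fun ψ =>
    sampleProtocol_probNeg M _ T f
  refine ⟨T, P, ?_, ?_⟩
  -- One 1/200 is the sampling error away from the bad set, the other will be the measure of the bad
  -- set.
  · have hae : ∀ᵐ ψ ∂ν, 1 - 1 / 200 - {ψ | h ψ ≤ 2 * δ}.indicator (fun _ => (1 : ℝ)) ψ
        ≤ P.probNeg (pureState ψ) := by
      filter_upwards [ae_haarVec_sum_normSq (fun _ => 0 : Fin K → Fin n)] with ψ hψ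
      have htr : (pureState ψ).trace = 1 := by rw [trace_pureState, hψ]; simp
      by_cases hS : h ψ ≤ 2 * δ
      · rw [Set.indicator_of_mem (show ψ ∈ {ψ | h ψ ≤ 2 * δ} from hS)]
        have := (P.probNeg_mem_Icc (fun M hM => born_nonneg hM ψ) htr).1
        linarith
      · rw [Set.indicator_of_notMem (show ψ ∉ {ψ | h ψ ≤ 2 * δ} from hS)]
        have hb := sampleMean_dist_bound hTpos (M.prob_pureState_nonneg ψ) (M.sum_prob htr) hδ
          (g := fun x => 1 + (-1) * negInd (f x))
          (fun x => by have := negInd_nonneg (f x); linarith) (fun x hx => by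
            have h1 : h ψ ≤ Metric.infDist (empirical x) Q + dist (M.prob (pureState ψ))
              (empirical x) := Metric.infDist_le_infDist_add_dist
            rw [dist_comm] at h1
            have h2 : f x < 0 := by simp only [hf]; linarith
            simp [negInd, h2])
        rw [sampleMean_add, sampleMean_mul_left, sampleMean_one (M.sum_prob htr), ← hprob] at hb
        linarith
    have hSm : MeasurableSet {ψ | h ψ ≤ 2 * δ} :=
      measurableSet_le hcont.measurable measurable_const
    have hi1 : Integrable ({ψ | h ψ ≤ 2 * δ}.indicator fun _ => (1 : ℝ)) ν :=
      (integrable_const _).indicator hSm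
    have hint := integral_mono_ae ((integrable_const (1 - 1 / 200 : ℝ)).sub hi1)
      (integrable_haarVec _ (P.continuous_probNeg.comp continuous_pureState)) hae
    simp only [Pi.sub_apply] at hint
    rw [integral_sub (integrable_const _) hi1, integral_indicator hSm] at hint
    simp only [integral_const, smul_eq_mul, mul_one, measureReal_restrict_apply_univ,
      probReal_univ, one_mul] at hint
    have : P.meanHaar = ∫ ψ, P.probNeg (pureState ψ) ∂ν := rfl
    rw [this]
    refine le_trans ?_ hint
    linarith
  · have hae : ∀ᵐ ρ ∂(haarProduct K n), P.probNeg ρ ≤ 1 / 200 := by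
      filter_upwards [ae_haarProduct_mem_productStates] with ρ hρ
      have hmem : M.prob ρ ∈ Q := Set.mem_image_of_mem _ hρ
      obtain ⟨U, rfl⟩ := hρ
      have htr : (pureState (tensorVec fun k => unitaryCol (0 : Fin n) (U k))).trace = 1 := by
        rw [← tensor_pureState, trace_tensor]
        refine Finset.prod_eq_one fun k _ => ?_
        rw [trace_pureState, sum_normSq_unitaryCol, Complex.ofReal_one]
      simp only at hmem ⊢
      rw [hprob]
      refine le_trans (sampleMean_dist_bound hTpos (M.prob_pureState_nonneg _) (M.sum_prob htr) hδ
        (fun x => negInd_le_one _) fun x hx => ?_) hbound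
      have h1 := (Metric.infDist_le_dist_of_mem (x := empirical x) hmem).trans_lt hx
      have h2 : ¬ f x < 0 := by simp only [hf]; linarith
      simp [negInd, h2]
    have : P.meanProduct = ∫ ρ, P.probNeg ρ ∂(haarProduct K n) :=
      (integral_haarProduct P.continuous_probNeg).symm
    rw [this]
    have hint := integral_mono_ae (integrable_haarProduct P.continuous_probNeg)
      (integrable_const (1 / 200 : ℝ)) hae
    simp at hint
    linarith

end

/-! ### Low moments of Haar random vectors -/

section
variable {ι : Type} [Fintype ι] [DecidableEq ι]

theorem prod_pow_single (f : ι → ℝ) (i : ι) (k : ℕ) :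
    ∏ l, f l ^ (Pi.single i k : ι → ℕ) l = f i ^ k := by
  rw [Finset.prod_eq_single i]
  · simp
  · intro l _ hl; simp [hl]
  · simp

theorem prod_factorial_single (i : ι) (k : ℕ) :
    ∏ l, (((Pi.single i k : ι → ℕ) l).factorial : ℝ) = k.factorial := by
  rw [Finset.prod_eq_single i]
  · simp
  · intro l _ hl; simp [hl]
  · simp

theorem integral_haarVec_pow_mul_pow (o i j : ι) (k l : ℕ) :
    ∫ ψ, (‖ψ i‖ ^ 2) ^ k * (‖ψ j‖ ^ 2) ^ l ∂(haarVec o)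
      = (if i = j then ((k + l).factorial : ℝ) else k.factorial * l.factorial)
        / ((Fintype.card ι).ascFactorial (k + l) : ℕ) := by
  have h := integral_haarVec_normSq_pow o (Pi.single i k + Pi.single j l)
  simp only [Pi.add_apply, pow_add, Finset.prod_mul_distrib,
    prod_pow_single (fun x => _ ^ 2), Finset.sum_add_distrib, Finset.sum_pi_single',
    Finset.mem_univ, if_true] at h
  rw [h]
  congr 1
  split_ifs with hij
  · subst hij
    rw [← prod_factorial_single i (k + l), Pi.single_add]
    rfl
  · rw [← prod_factorial_single i k, ← prod_factorial_single j l, ← Finset.prod_mul_distrib]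
    refine Finset.prod_congr rfl fun x _ => ?_
    by_cases hx : x = i
    · subst hx; simp [hij]
    · simp [hx]

theorem integral_haarVec_pow (o i : ι) (k : ℕ) :
    ∫ ψ, (‖ψ i‖ ^ 2) ^ k ∂(haarVec o)
      = (k.factorial : ℝ) / ((Fintype.card ι).ascFactorial k : ℕ) := by
  have h := integral_haarVec_pow_mul_pow o i i k 0
  simpa using h

end

theorem ascFactorial_two (n : ℕ) : (n.ascFactorial 2 : ℝ) = n * (n + 1) := by
  simp [Nat.ascFactorial]; ring

theorem ascFactorial_three (n : ℕ) : (n.ascFactorial 3 : ℝ) = n * (n + 1) * (n + 2) := by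
  simp [Nat.ascFactorial]; ring

theorem ascFactorial_four (n : ℕ) :
    (n.ascFactorial 4 : ℝ) = n * (n + 1) * (n + 2) * (n + 3) := by
  simp [Nat.ascFactorial]; ring

section
variable {n : ℕ}

theorem integral_sum_sq (hn : 0 < n) (o : Fin n) :
    ∫ ψ, ∑ i, (‖ψ i‖ ^ 2) ^ 2 ∂(haarVec o) = 2 / ((n : ℝ) + 1) := by
  have hn' : (0 : ℝ) < n := by exact_mod_cast hn
  rw [integral_finsetSum _ fun i _ => integrable_haarVec o (by fun_prop)]
  simp only [integral_haarVec_pow, Finset.sum_const, Finset.card_univ, Fintype.card_fin,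
    nsmul_eq_mul, ascFactorial_two, Nat.factorial]
  push_cast
  field_simp

theorem integral_sum_cube (hn : 0 < n) (o : Fin n) :
    ∫ ψ, ∑ i, (‖ψ i‖ ^ 2) ^ 3 ∂(haarVec o) = 6 / (((n : ℝ) + 1) * (n + 2)) := by
  have hn' : (0 : ℝ) < n := by exact_mod_cast hn
  rw [integral_finsetSum _ fun i _ => integrable_haarVec o (by fun_prop)]
  simp only [integral_haarVec_pow, Finset.sum_const, Finset.card_univ, Fintype.card_fin,
    nsmul_eq_mul, ascFactorial_three, Nat.factorial]
  push_cast
  field_simp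

theorem integral_sum_sq_sq (hn : 0 < n) (o : Fin n) :
    ∫ ψ, (∑ i, (‖ψ i‖ ^ 2) ^ 2) ^ 2 ∂(haarVec o)
      = (4 * n + 20) / (((n : ℝ) + 1) * (n + 2) * (n + 3)) := by
  have hn' : (0 : ℝ) < n := by exact_mod_cast hn
  simp only [sq (∑ i, _), Finset.sum_mul_sum]
  rw [integral_finsetSum _ fun i _ => integrable_haarVec o (by fun_prop)]
  have h : ∀ i j : Fin n, (if i = j then (((2 + 2).factorial : ℕ) : ℝ) else
      (Nat.factorial 2 : ℝ) * (Nat.factorial 2 : ℝ)) = 4 + if i = j then 20 else 0 := by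
    intro i j
    split_ifs <;> norm_num [Nat.factorial]
  have h1 : ∀ i, ∫ ψ, ∑ j, (‖ψ i‖ ^ 2) ^ 2 * (‖ψ j‖ ^ 2) ^ 2 ∂(haarVec o)
      = ∑ j, (4 + if i = j then (20 : ℝ) else 0) / (n * (n + 1) * (n + 2) * (n + 3)) := by
    intro i
    rw [integral_finsetSum _ fun j _ => integrable_haarVec o (by fun_prop)]
    refine Finset.sum_congr rfl fun j _ => ?_
    rw [integral_haarVec_pow_mul_pow, h, Fintype.card_fin, ascFactorial_four]
  simp only [h1, ← Finset.sum_div, Finset.sum_add_distrib, Finset.sum_ite_eq, Finset.mem_univ,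
    if_true, Finset.sum_const, Finset.card_univ, Fintype.card_fin, nsmul_eq_mul]
  field_simp

end

/-! ### The collision statistic -/

section
variable {m s : ℕ} {p : Fin m → ℝ}

/-- The number of coincidences between the first and the second half of the samples. -/
def collisions (x : Fin (s + s) → Fin m) : ℝ :=
  ∑ i, count (fun a => x (Fin.castAdd s a)) i * count (fun a => x (Fin.natAdd s a)) i

theorem collisions_nonneg (x : Fin (s + s) → Fin m) : 0 ≤ collisions x :=
  Finset.sum_nonneg fun i _ => mul_nonneg
    (Finset.sum_nonneg fun _ _ => by split_ifs <;> norm_num)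
    (Finset.sum_nonneg fun _ _ => by split_ifs <;> norm_num)

/-- The two halves are independent; this is why collisions are counted across halves, since their
moments become products of count moments. -/
theorem sampleMean_halves (f g : (Fin s → Fin m) → ℝ) :
    sampleMean p (fun x : Fin (s + s) → Fin m =>
      f (fun a => x (Fin.castAdd s a)) * g (fun a => x (Fin.natAdd s a)))
      = sampleMean p f * sampleMean p g := by
  unfold sampleMean
  rw [Finset.sum_mul_sum, ← Fintype.sum_prod_type', ← (Fin.appendEquiv s s).sum_comp]
  refine Finset.sum_congr rfl fun x _ => ?_
  simp only [Fin.appendEquiv_apply, Fin.prod_univ_add, Fin.append_left, Fin.append_right]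
  ring

theorem sampleMean_collisions (hp : ∑ i, p i = 1) :
    sampleMean p (collisions : (Fin (s + s) → Fin m) → ℝ) = (s : ℝ) ^ 2 * ∑ i, p i ^ 2 := by
  unfold collisions
  rw [sampleMean_sum, Finset.mul_sum]
  refine Finset.sum_congr rfl fun i _ => ?_
  rw [sampleMean_halves (fun x => count x i) fun x => count x i, sampleMean_count hp]
  ring

theorem sampleMean_collisions_sq (hp : ∑ i, p i = 1) :
    sampleMean p (fun x : Fin (s + s) → Fin m => collisions x ^ 2)
      = ((s : ℝ) * (s - 1)) ^ 2 * (∑ i, p i ^ 2) ^ 2 + 2 * ((s : ℝ) * (s - 1)) * s * ∑ i, p i ^ 3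
        + (s : ℝ) ^ 2 * ∑ i, p i ^ 2 := by
  have h : (fun x : Fin (s + s) → Fin m => collisions x ^ 2) = fun x => ∑ i, ∑ j,
      (count (fun a => x (Fin.castAdd s a)) i * count (fun a => x (Fin.castAdd s a)) j) *
      (count (fun a => x (Fin.natAdd s a)) i * count (fun a => x (Fin.natAdd s a)) j) := by
    funext x
    rw [collisions, sq, Finset.sum_mul_sum]
    exact Finset.sum_congr rfl fun i _ => Finset.sum_congr rfl fun j _ => by ring
  rw [h, sampleMean_sum]
  simp only [sampleMean_sum]
  have h1 : ∀ i j : Fin m, sampleMean p (fun x : Fin (s + s) → Fin m =>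
      (count (fun a => x (Fin.castAdd s a)) i * count (fun a => x (Fin.castAdd s a)) j) *
      (count (fun a => x (Fin.natAdd s a)) i * count (fun a => x (Fin.natAdd s a)) j))
      = ((s : ℝ) * (s - 1)) ^ 2 * (p i ^ 2 * p j ^ 2) + if i = j then
        (2 * ((s : ℝ) * (s - 1)) * s * p i ^ 3 + (s : ℝ) ^ 2 * p i ^ 2) else 0 := by
    intro i j
    rw [sampleMean_halves (fun x => count x i * count x j) fun x => count x i * count x j,
      sampleMean_count_mul_count hp]
    split_ifs with hij
    · subst hij; ring
    · ring
  simp only [h1, Finset.sum_add_distrib, Finset.sum_ite_eq, Finset.mem_univ, if_true]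
  simp only [← Finset.mul_sum]
  rw [sq (∑ i, p i ^ 2), Finset.sum_mul]
  ring

/-- Markov's inequality for the number of collisions. -/
theorem one_sub_le_sampleMean_collisions (hp0 : ∀ i, 0 ≤ p i) (hp : ∑ i, p i = 1) {θ : ℝ}
    (hθ : 0 < θ) :
    1 - (s : ℝ) ^ 2 / θ * ∑ i, p i ^ 2 ≤
      sampleMean p (fun x : Fin (s + s) → Fin m => negInd (collisions x - θ)) := by
  have h := sampleMean_mono (T := s + s) hp0
    (f := fun x => 1 + (-θ⁻¹) * collisions x) (g := fun x => negInd (collisions x - θ)) (by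
      intro x
      have h0 := collisions_nonneg x
      by_cases hx : collisions x - θ < 0
      · have : 0 ≤ θ⁻¹ * collisions x := by positivity
        simp only [negInd, hx, if_true]
        linarith
      · have : 1 ≤ θ⁻¹ * collisions x := by
          rw [inv_mul_eq_div, le_div_iff₀ hθ]; linarith
        simp only [negInd, hx, if_false]
        linarith)
  rw [sampleMean_add, sampleMean_one hp, sampleMean_mul_left, sampleMean_collisions hp] at h
  refine le_trans (le_of_eq ?_) h
  ring

/-- Chebyshev's inequality for the number of collisions. -/
theorem sampleMean_collisions_le (hp0 : ∀ i, 0 ≤ p i) (hp : ∑ i, p i = 1) {θ μ : ℝ}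
    (hθ : θ < μ) :
    sampleMean p (fun x : Fin (s + s) → Fin m => negInd (collisions x - θ)) ≤
      ((s : ℝ) ^ 4 * (∑ i, p i ^ 2) ^ 2 + 2 * (s : ℝ) ^ 3 * ∑ i, p i ^ 3
        + (s : ℝ) ^ 2 * (1 - 2 * μ) * ∑ i, p i ^ 2 + μ ^ 2) / (μ - θ) ^ 2 := by
  have hd : 0 < μ - θ := sub_pos.mpr hθ
  -- The centre `μ` need not be the mean for this particular `p`: the bound is stated so that it can
  -- still be averaged over a random `p`.
  have h := sampleMean_mono (T := s + s) hp0
    (f := fun x => negInd (collisions x - θ))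
    (g := fun x => ((μ - θ) ^ 2)⁻¹ * (collisions x ^ 2 + ((-2 * μ) * collisions x + μ ^ 2 * 1))) (by
      intro x
      have hsq : collisions x ^ 2 + ((-2 * μ) * collisions x + μ ^ 2 * 1)
          = (μ - collisions x) ^ 2 := by ring
      simp only [hsq]
      by_cases hx : collisions x - θ < 0
      · simp only [negInd, hx, if_true]
        rw [inv_mul_eq_div, le_div_iff₀ (by positivity), one_mul]
        exact pow_le_pow_left₀ hd.le (by linarith) 2
      · simp only [negInd, hx, if_false]
        positivity)
  rw [sampleMean_mul_left, sampleMean_add, sampleMean_add, sampleMean_mul_left,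
    sampleMean_mul_left, sampleMean_one hp, sampleMean_collisions hp,
    sampleMean_collisions_sq hp] at h
  refine h.trans ?_
  rw [inv_mul_eq_div]
  refine div_le_div_of_nonneg_right ?_ (by positivity)
  have hs1 : ((s : ℝ) * (s - 1)) ^ 2 ≤ (s : ℝ) ^ 4 ∧ (s : ℝ) * (s - 1) * s ≤ (s : ℝ) ^ 3 := by
    rcases Nat.eq_zero_or_pos s with h0 | h0
    · subst h0; simp
    · have : (1 : ℝ) ≤ s := by exact_mod_cast h0
      constructor
      · calc ((s : ℝ) * (s - 1)) ^ 2 ≤ ((s : ℝ) * s) ^ 2 :=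
            pow_le_pow_left₀ (by nlinarith) (by nlinarith) 2
          _ = (s : ℝ) ^ 4 := by ring
      · nlinarith
  have e1 : 0 ≤ (∑ i, p i ^ 2) ^ 2 := by positivity
  have e2 : 0 ≤ ∑ i, p i ^ 3 := Finset.sum_nonneg fun i _ => pow_nonneg (hp0 i) 3
  nlinarith [mul_le_mul_of_nonneg_right hs1.1 e1, mul_le_mul_of_nonneg_right hs1.2 e2]

end

/-! ### Measuring one tensor factor -/

section
variable {K n : ℕ}

/-- The standard basis measurement of the first tensor factor. -/
def localPOVM (K n : ℕ) : POVM (Fin (K + 1) → Fin n) n where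
  elem i := Matrix.diagonal fun x => if x 0 = i then 1 else 0
  posSemidef i := PosSemidef.diagonal fun x => by
    simp only [Pi.zero_apply]
    split_ifs <;> simp
  sum_eq_one := by
    ext x y
    rw [Matrix.sum_apply]
    by_cases h : x = y
    · subst h; simp
    · simp [h]

theorem localPOVM_prob (φ : (Fin (K + 1) → Fin n) → ℂ) (i : Fin n) :
    (localPOVM K n).prob (pureState φ) i = ∑ y : Fin K → Fin n, ‖φ (Fin.cons i y)‖ ^ 2 := by
  change born _ φ = _
  rw [born_eq]
  simp only [localPOVM, dotProduct, mulVec_diagonal, Pi.star_apply]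
  rw [sum_consEquiv, Finset.sum_eq_single i]
  · simp only [Fin.cons_zero, if_true, one_mul]
    have : ∀ y : Fin K → Fin n, star (φ (Fin.cons i y)) * φ (Fin.cons i y)
        = ((‖φ (Fin.cons i y)‖ ^ 2 : ℝ) : ℂ) := by
      intro y; push_cast; exact Complex.conj_mul' _
    simp only [this, ← Complex.ofReal_sum, Complex.ofReal_re]
  · intro j _ hj
    simp [hj]
  · simp

theorem localPOVM_prob_tensorVec {ψ : Fin (K + 1) → Fin n → ℂ}
    (hψ : ∀ k, ∑ i, ‖ψ k i‖ ^ 2 = 1) (i : Fin n) :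
    (localPOVM K n).prob (pureState (tensorVec ψ)) i = ‖ψ 0 i‖ ^ 2 := by
  rw [localPOVM_prob]
  simp only [tensorVec, Fin.prod_univ_succ, Fin.cons_zero, Fin.cons_succ, norm_mul, mul_pow,
    norm_prod, ← Finset.prod_pow]
  rw [← Finset.mul_sum, ← Fintype.piFinset_univ, ← Finset.prod_univ_sum (fun _ => Finset.univ)
    (fun k i => ‖ψ (Fin.succ k) i‖ ^ 2)]
  simp [hψ]

/-- For K ≥ 1 this is close to 1/n, since the other factors average out the fluctuations of the
local distribution; for a Haar random local vector `integral_sum_sq` gives 2/(n+1). The collision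
test detects this factor of about two. -/
theorem integral_localPOVM_sum_sq (hn : 0 < n) (o : Fin (K + 1) → Fin n) :
    ∫ φ, ∑ i, (localPOVM K n).prob (pureState φ) i ^ 2 ∂(haarVec o)
      = ((n : ℝ) ^ K + 1) / ((n : ℝ) ^ (K + 1) + 1) := by
  have hn' : (0 : ℝ) < n := by exact_mod_cast hn
  simp only [localPOVM_prob, sq (∑ y, _), Finset.sum_mul_sum]
  rw [integral_finsetSum _ fun i _ => integrable_haarVec o (by fun_prop)]
  have h1 : ∀ i : Fin n, ∫ φ, ∑ x : Fin K → Fin n, ∑ y : Fin K → Fin n,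
      ‖φ (Fin.cons i x : Fin (K + 1) → Fin n)‖ ^ 2 * ‖φ (Fin.cons i y : Fin (K + 1) → Fin n)‖ ^ 2
        ∂(haarVec o)
      = ∑ x : Fin K → Fin n, ∑ y : Fin K → Fin n, (1 + if x = y then (1 : ℝ) else 0) /
        ((n : ℝ) ^ (K + 1) * ((n : ℝ) ^ (K + 1) + 1)) := by
    intro i
    rw [integral_finsetSum _ fun i _ => integrable_haarVec o (by fun_prop)]
    refine Finset.sum_congr rfl fun x _ => ?_
    rw [integral_finsetSum _ fun i _ => integrable_haarVec o (by fun_prop)]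
    refine Finset.sum_congr rfl fun y _ => ?_
    have h := integral_haarVec_pow_mul_pow o (Fin.cons i x : Fin (K + 1) → Fin n) (Fin.cons i y) 1 1
    simp only [pow_one, one_add_one_eq_two, ascFactorial_two, Fin.cons_inj, true_and] at h
    rw [h]
    congr 1
    · split_ifs <;> norm_num [Nat.factorial]
    · simp
  simp only [h1, ← Finset.sum_div, Finset.sum_add_distrib, Finset.sum_ite_eq, Finset.mem_univ,
    if_true, Finset.sum_const, Finset.card_univ, Fintype.card_fin, nsmul_eq_mul, Fintype.card_pi,
    Finset.prod_const]
  push_cast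
  rw [pow_succ']
  field_simp

end

/-! ### The collision protocol -/

section
variable {K n : ℕ} [NeZero n]

theorem le_meanHaar_collisions (s : ℕ) {θ : ℝ} (hθ : 0 < θ) :
    1 - (s : ℝ) ^ 2 / θ * (((n : ℝ) ^ K + 1) / ((n : ℝ) ^ (K + 1) + 1)) ≤
      (sampleProtocol (localPOVM K n) (s + s) fun x => collisions x - θ).meanHaar := by
  set P := sampleProtocol (localPOVM K n) (s + s) fun x => collisions x - θ with hP
  set o : Fin (K + 1) → Fin n := fun _ => 0
  have hcont : ∀ i, Continuous fun φ => (localPOVM K n).prob (pureState φ) i := fun i =>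
    (continuous_apply i).comp ((localPOVM K n).continuous_prob.comp continuous_pureState)
  have hae : ∀ᵐ φ ∂(haarVec o),
      1 - (s : ℝ) ^ 2 / θ * ∑ i, (localPOVM K n).prob (pureState φ) i ^ 2
        ≤ P.probNeg (pureState φ) := by
    filter_upwards [ae_haarVec_sum_normSq o] with φ hφ
    rw [hP, sampleProtocol_probNeg]
    exact one_sub_le_sampleMean_collisions ((localPOVM K n).prob_pureState_nonneg φ)
      ((localPOVM K n).sum_prob (isDensity_pureState hφ).2) hθ
  have hi : Integrable (fun φ => (s : ℝ) ^ 2 / θ *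
      ∑ i, (localPOVM K n).prob (pureState φ) i ^ 2) (haarVec o) :=
    integrable_haarVec o (continuous_const.mul
      (continuous_finsetSum _ fun i _ => (hcont i).pow 2))
  have h := integral_mono_ae ((integrable_const (1 : ℝ)).sub hi)
    (integrable_haarVec o (P.continuous_probNeg.comp continuous_pureState)) hae
  simp only [Pi.sub_apply] at h
  rw [integral_sub (integrable_const _) hi, integral_const_mul,
    integral_localPOVM_sum_sq (Nat.pos_of_ne_zero (NeZero.ne n))] at h
  have hmean : P.meanHaar = ∫ ψ, P.probNeg (pureState ψ) ∂(haarVec o) := rfl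
  rw [hmean]
  simpa using h

/-- On a product state the local measurement sees only the first factor, so Chebyshev's bound is a
function of `ψ 0` and its mean follows from three Haar moments in dimension n. -/
theorem meanProduct_collisions_le (s : ℕ) {θ μ : ℝ} (hθ : θ < μ) :
    (sampleProtocol (localPOVM K n) (s + s) fun x => collisions x - θ).meanProduct ≤
      ((s : ℝ) ^ 4 * ((4 * n + 20) / (((n : ℝ) + 1) * (n + 2) * (n + 3)))
        + 2 * (s : ℝ) ^ 3 * (6 / (((n : ℝ) + 1) * (n + 2)))
        + (s : ℝ) ^ 2 * (1 - 2 * μ) * (2 / ((n : ℝ) + 1)) + μ ^ 2) / (μ - θ) ^ 2 := by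
  set P := sampleProtocol (localPOVM K n) (s + s) fun x => collisions x - θ with hP
  have hn : 0 < n := Nat.pos_of_ne_zero (NeZero.ne n)
  set ν := Measure.pi fun _ : Fin (K + 1) => haarVec (0 : Fin n) with hν
  have hnorm : ∀ᵐ ψ ∂ν, ∀ k, ∑ i, ‖ψ k i‖ ^ 2 = 1 := by
    rw [ae_all_iff]
    intro k
    exact (measurePreserving_eval (fun _ : Fin (K + 1) => haarVec (0 : Fin n)) k).quasiMeasurePreserving.ae
      (ae_haarVec_sum_normSq (0 : Fin n))
  set G : (Fin n → ℂ) → ℝ := fun v =>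
    ((s : ℝ) ^ 4 * (∑ i, (‖v i‖ ^ 2) ^ 2) ^ 2 + 2 * (s : ℝ) ^ 3 * ∑ i, (‖v i‖ ^ 2) ^ 3
      + (s : ℝ) ^ 2 * (1 - 2 * μ) * ∑ i, (‖v i‖ ^ 2) ^ 2 + μ ^ 2) / (μ - θ) ^ 2 with hG
  have hGc : Continuous G := by
    rw [hG]; fun_prop
  have hae : ∀ᵐ ψ ∂ν, P.probNeg (pureState (tensorVec ψ)) ≤ G (ψ 0) := by
    filter_upwards [hnorm] with ψ hψ
    have htr : (pureState (tensorVec ψ)).trace = 1 := by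
      rw [← tensor_pureState, trace_tensor]
      refine Finset.prod_eq_one fun k _ => ?_
      rw [trace_pureState, hψ, Complex.ofReal_one]
    rw [hP, sampleProtocol_probNeg]
    refine (sampleMean_collisions_le ((localPOVM K n).prob_pureState_nonneg (tensorVec ψ))
      ((localPOVM K n).sum_prob htr) hθ).trans (le_of_eq ?_)
    simp only [localPOVM_prob_tensorVec hψ, hG]
  have hGi : Integrable (fun ψ : Fin (K + 1) → Fin n → ℂ => G (ψ 0)) ν :=
    integrable_pi_haarVec (hGc.comp (continuous_apply 0))
  have h := integral_mono_ae (integrable_pi_haarVec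
    (P.continuous_probNeg.comp (continuous_pureState.comp continuous_tensorVec))) hGi hae
  have hmarg : ∫ ψ, G (ψ 0) ∂ν = ∫ v, G v ∂(haarVec (0 : Fin n)) := by
    have hmp := measurePreserving_eval (fun _ : Fin (K + 1) => haarVec (0 : Fin n)) 0
    conv_rhs => rw [← hmp.map_eq]
    exact (integral_map hmp.measurable.aemeasurable hGc.aestronglyMeasurable).symm
  have hmean : P.meanProduct = ∫ ψ, P.probNeg (pureState (tensorVec ψ)) ∂ν :=
    integral_productVec (P.continuous_probNeg.comp continuous_pureState)
  rw [hmean]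
  refine h.trans (le_of_eq ?_)
  rw [hmarg, hG, integral_div]
  congr 1
  have i1 : Integrable (fun v : Fin n → ℂ => (s : ℝ) ^ 4 * (∑ i, (‖v i‖ ^ 2) ^ 2) ^ 2)
    (haarVec (0 : Fin n)) := integrable_haarVec _ (by fun_prop)
  have i2 : Integrable (fun v : Fin n → ℂ => 2 * (s : ℝ) ^ 3 * ∑ i, (‖v i‖ ^ 2) ^ 3)
    (haarVec (0 : Fin n)) := integrable_haarVec _ (by fun_prop)
  have i3 : Integrable (fun v : Fin n → ℂ => (s : ℝ) ^ 2 * (1 - 2 * μ) * ∑ i, (‖v i‖ ^ 2) ^ 2)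
    (haarVec (0 : Fin n)) := integrable_haarVec _ (by fun_prop)
  have i12 : Integrable (fun v : Fin n → ℂ => (s : ℝ) ^ 4 * (∑ i, (‖v i‖ ^ 2) ^ 2) ^ 2
    + 2 * (s : ℝ) ^ 3 * ∑ i, (‖v i‖ ^ 2) ^ 3) (haarVec (0 : Fin n)) := i1.add i2
  have i123 : Integrable (fun v : Fin n → ℂ => (s : ℝ) ^ 4 * (∑ i, (‖v i‖ ^ 2) ^ 2) ^ 2
    + 2 * (s : ℝ) ^ 3 * ∑ i, (‖v i‖ ^ 2) ^ 3
    + (s : ℝ) ^ 2 * (1 - 2 * μ) * ∑ i, (‖v i‖ ^ 2) ^ 2) (haarVec (0 : Fin n)) := i12.add i3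
  rw [integral_add i123 (integrable_const _), integral_add i12 i3, integral_add i1 i2,
    integral_const_mul, integral_const_mul, integral_const_mul, integral_sum_sq hn,
    integral_sum_cube hn, integral_sum_sq_sq hn]
  simp

theorem exists_collision_protocol (hK : 1 ≤ K) (hn : 10 ^ 6 ≤ n) :
    ∃ (T : ℕ) (P : Protocol (Fin (K + 1) → Fin n) T),
      (T : ℝ) ≤ 202 * Real.sqrt n ∧ 41 / 100 ≤ P.meanHaar ∧ P.meanProduct ≤ 1 / 100 := by
  have hn' : (10 : ℝ) ^ 6 ≤ n := by exact_mod_cast hn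
  have hn0 : (0 : ℝ) < n := by linarith
  -- This makes s²/n at least 10⁴, so the counting noise is small against the mean number of
  -- collisions.
  set s : ℕ := ⌈100 * Real.sqrt n⌉₊ with hs
  have hs1 : 100 * Real.sqrt n ≤ s := Nat.le_ceil _
  have hs2 : (s : ℝ) < 100 * Real.sqrt n + 1 := Nat.ceil_lt_add_one (by positivity)
  have hsq : Real.sqrt n ^ 2 = n := Real.sq_sqrt hn0.le
  have hsqrt : (1000 : ℝ) ≤ Real.sqrt n := Real.le_sqrt_of_sq_le (by norm_num; linarith)
  have hs0 : (100000 : ℝ) ≤ s := by linarith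
  have hsn : 10000 * (n : ℝ) ≤ (s : ℝ) ^ 2 := by nlinarith
  have hspos : (0 : ℝ) < s := by linarith
  have hn1 : (0 : ℝ) < (n : ℝ) + 1 := by linarith
  -- μ is the mean number of collisions for product states, about twice that for Haar states. The
  -- threshold θ = 0.85 μ gives Markov's inequality the ratio 10/17 < 59/100 on the Haar side and
  -- leaves Chebyshev's inequality the gap 0.15 μ on the product side.
  set μ : ℝ := 2 * (s : ℝ) ^ 2 / (n + 1) with hμ
  set θ : ℝ := 17 / 10 * (s : ℝ) ^ 2 / (n + 1) with hθ
  have hθ0 : 0 < θ := by positivity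
  have hd : μ - θ = 3 / 10 * (s : ℝ) ^ 2 / (n + 1) := by rw [hμ, hθ]; ring
  have hθμ : θ < μ := by
    have : 0 < μ - θ := by rw [hd]; positivity
    linarith
  refine ⟨s + s, sampleProtocol (localPOVM K n) (s + s) fun x => collisions x - θ, ?_, ?_, ?_⟩
  · push_cast; linarith
  · refine le_trans ?_ (le_meanHaar_collisions s hθ0)
    have hm : (n : ℝ) ≤ (n : ℝ) ^ K := le_self_pow₀ (by linarith) (by omega)
    set m : ℝ := (n : ℝ) ^ K with hmdef
    have e1 : (s : ℝ) ^ 2 / θ = 10 / 17 * (n + 1) := by rw [hθ]; field_simp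
    rw [e1, pow_succ, ← hmdef]
    have e2 : 10 / 17 * ((n : ℝ) + 1) * ((m + 1) / (m * n + 1)) ≤ 59 / 100 := by
      rw [mul_div_assoc', div_le_iff₀ (by positivity)]
      nlinarith
    linarith
  · refine (meanProduct_collisions_le s hθμ).trans ?_
    rw [hd, div_le_iff₀ (by positivity)]
    have hμs : (s : ℝ) ^ 2 * (1 - 2 * μ) * (2 / ((n : ℝ) + 1)) + μ ^ 2 = μ - μ ^ 2 := by
      rw [hμ]; field_simp; ring
    -- The variance has three parts, in units of s⁴/(n+1)²: the randomness of the distribution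
    -- (`h4`), triple coincidences (`h3`) and counting noise (`h2`). Their coefficients 4·10⁻⁶,
    -- 12·10⁻⁵ and 4·10⁻⁴ add up to less than 9·10⁻⁴ = (3/10)²/100.
    have h4 : (s : ℝ) ^ 4 * ((4 * n + 20) / (((n : ℝ) + 1) * (n + 2) * (n + 3))) - μ ^ 2
        ≤ (s : ℝ) ^ 4 / (n + 1) ^ 2 * (4 / 10 ^ 6) := by
      have e4 : (s : ℝ) ^ 4 * ((4 * n + 20) / (((n : ℝ) + 1) * (n + 2) * (n + 3))) - μ ^ 2
          = (s : ℝ) ^ 4 / (n + 1) ^ 2 * ((4 * n - 4) / ((n + 2) * (n + 3))) := by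
        rw [hμ]; field_simp; ring
      rw [e4]
      refine mul_le_mul_of_nonneg_left ?_ (by positivity)
      rw [div_le_div_iff₀ (by positivity) (by norm_num)]
      nlinarith
    have h3 : 2 * (s : ℝ) ^ 3 * (6 / (((n : ℝ) + 1) * (n + 2)))
        ≤ (s : ℝ) ^ 4 / (n + 1) ^ 2 * (12 / 10 ^ 5) := by
      have e3 : 2 * (s : ℝ) ^ 3 * (6 / (((n : ℝ) + 1) * (n + 2)))
          ≤ 2 * (s : ℝ) ^ 3 * (6 / ((n : ℝ) + 1) ^ 2) := by
        gcongr
        nlinarith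
      refine e3.trans ?_
      have e3' : (s : ℝ) ^ 4 / ((n : ℝ) + 1) ^ 2 * (12 / 10 ^ 5)
          - 2 * (s : ℝ) ^ 3 * (6 / ((n : ℝ) + 1) ^ 2)
          = 12 / 10 ^ 5 * ((s : ℝ) ^ 3 / ((n : ℝ) + 1) ^ 2) * (s - 100000) := by
        field_simp; ring
      have : 0 ≤ 12 / 10 ^ 5 * ((s : ℝ) ^ 3 / ((n : ℝ) + 1) ^ 2) * (s - 100000) :=
        mul_nonneg (by positivity) (by linarith)
      linarith
    have h2 : μ ≤ (s : ℝ) ^ 4 / (n + 1) ^ 2 * (4 / 10 ^ 4) := by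
      have e2 : (s : ℝ) ^ 4 / ((n : ℝ) + 1) ^ 2 * (4 / 10 ^ 4) - μ
          = 4 / 10 ^ 4 * ((s : ℝ) ^ 2 / ((n : ℝ) + 1) ^ 2) * (s ^ 2 - 5000 * (n + 1)) := by
        rw [hμ]; field_simp; ring
      have : 0 ≤ 4 / 10 ^ 4 * ((s : ℝ) ^ 2 / ((n : ℝ) + 1) ^ 2) * (s ^ 2 - 5000 * (n + 1)) :=
        mul_nonneg (by positivity) (by linarith)
      linarith
    have hX : 0 ≤ (s : ℝ) ^ 4 / ((n : ℝ) + 1) ^ 2 := by positivity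
    have e : 1 / 100 * (3 / 10 * (s : ℝ) ^ 2 / ((n : ℝ) + 1)) ^ 2
        = (s : ℝ) ^ 4 / (n + 1) ^ 2 * (9 / 10000) := by
      field_simp; ring
    rw [e]
    nlinarith

end

/-- Distinguishing protocols with `O(√n)` copies in every dimension. -/
theorem exists_protocol_sqrt (K : ℕ) (hK : 2 ≤ K) :
    ∃ C : ℝ, 0 < C ∧ ∀ (n : ℕ) [NeZero n], 2 ≤ n →
      ∃ (T : ℕ) (P : Protocol (Fin K → Fin n) T),
        (T : ℝ) ≤ C * Real.sqrt n ∧ 41 / 100 ≤ P.meanHaar ∧ P.meanProduct ≤ 1 / 100 := by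
  -- The instance is quantified after T so that `choose` yields a function on all of ℕ; for n < 2
  -- the value 0 is a dummy.
  have hsmall : ∀ n : ℕ, ∃ T : ℕ, ∀ [NeZero n], 2 ≤ n → ∃ P : Protocol (Fin K → Fin n) T,
      41 / 100 ≤ P.meanHaar ∧ P.meanProduct ≤ 1 / 100 := by
    intro n
    by_cases hn : 2 ≤ n
    · have : NeZero n := ⟨by omega⟩
      obtain ⟨T, P, h1, h2⟩ := exists_tomography_protocol hK hn
      exact ⟨T, fun _ => ⟨P, by linarith, h2⟩⟩
    · exact ⟨0, fun h => absurd h hn⟩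
  choose T hT using hsmall
  -- The sum bounds each of the finitely many tomography costs, and √n ≥ 1 turns it into a multiple
  -- of √n.
  set C0 : ℝ := ∑ n ∈ Finset.range (10 ^ 6), (T n : ℝ) with hC0
  have hC0n : 0 ≤ C0 := Finset.sum_nonneg fun _ _ => Nat.cast_nonneg _
  refine ⟨202 + C0, by linarith, fun n _ hn => ?_⟩
  have h1n : 1 ≤ Real.sqrt n := Real.one_le_sqrt.mpr (by exact_mod_cast (by omega : 1 ≤ n))
  by_cases hbig : 10 ^ 6 ≤ n
  · obtain ⟨K', rfl⟩ : ∃ K', K = K' + 1 := ⟨K - 1, by omega⟩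
    obtain ⟨T', P, h1, h2, h3⟩ := exists_collision_protocol (K := K') (by omega) hbig
    refine ⟨T', P, h1.trans ?_, h2, h3⟩
    nlinarith
  · obtain ⟨P, h2, h3⟩ := hT n hn
    refine ⟨T n, P, ?_, h2, h3⟩
    have : (T n : ℝ) ≤ C0 := Finset.single_le_sum (f := fun n => (T n : ℝ))
      (fun _ _ => Nat.cast_nonneg _) (Finset.mem_range.mpr (not_le.mp hbig))
    nlinarith

end EntDetect

theorem mainTheorem2 (K : ℕ) (hK : 2 ≤ K) :
    ∃ c C : ℝ, 0 < c ∧ 0 < C ∧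
      ∀ (d n : ℕ) [NeZero n], 2 ≤ n → d = n ^ K →
        (∀ (T : ℕ) (P : EntDetect.Protocol (Fin K → Fin n) T),
          P.completeness = 1 / 4 → P.soundness = 5 / 6 →
            c * (d : ℝ) ^ (1 / (2 * (K : ℝ))) ≤ (T : ℝ)) ∧
        (∃ (T : ℕ) (P : EntDetect.Protocol (Fin K → Fin n) T),
          P.completeness = 1 / 4 ∧ P.soundness = 5 / 6 ∧
            (T : ℝ) ≤ C * (d : ℝ) ^ (1 / (2 * (K : ℝ)))) := by
  obtain ⟨C, hC, hprot⟩ := EntDetect.exists_protocol_sqrt K hK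
  have hK0 : (0 : ℝ) < K := by exact_mod_cast (by omega : 0 < K)
  -- The gap 1/3 ≤ K T²/n gives n ≤ 3K T², and √(3K) is bounded by 3K. The added 1 in the upper
  -- constant pays for the calibration copy, as √n ≥ 1.
  refine ⟨1 / (3 * K), C + 1, by positivity, by positivity, ?_⟩
  intro d n _ hn hd
  have hn0 : (0 : ℝ) < n := by exact_mod_cast (by omega : 0 < n)
  have hroot : (d : ℝ) ^ (1 / (2 * (K : ℝ))) = Real.sqrt n := by
    rw [hd, Nat.cast_pow, ← Real.rpow_natCast, ← Real.rpow_mul hn0.le, Real.sqrt_eq_rpow]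
    congr 1
    field_simp
  rw [hroot]
  refine ⟨fun T P hcomp hsound => ?_, ?_⟩
  · obtain ⟨ha, hb⟩ := (P.completeness_soundness_iff hK hn).mp ⟨hcomp, hsound⟩
    have h := P.meanHaar_sub_meanProduct_le (by omega)
    rw [ha, hb] at h
    have h1 : (n : ℝ) ≤ 3 * K * (T : ℝ) ^ 2 := by
      rw [mul_div_assoc', le_div_iff₀ hn0] at h
      linarith
    have h2 : Real.sqrt n ≤ 3 * K * T := by
      refine Real.sqrt_le_iff.mpr ⟨by positivity, h1.trans ?_⟩
      have hK1 : (1 : ℝ) ≤ K := by exact_mod_cast (by omega : 1 ≤ K)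
      have : 3 * (K : ℝ) ≤ (3 * K) ^ 2 := by nlinarith
      rw [mul_pow]
      exact mul_le_mul_of_nonneg_right this (by positivity)
    rw [one_div, inv_mul_le_iff₀ (by positivity)]
    exact h2
  · obtain ⟨T, P, hT, ha, hb⟩ := hprot n hn
    -- With a ≥ 0.41 and b ≤ 0.01 the calibration conditions hold: 5b ≤ 0.05 and 4 + 7b ≤ 4.07 <
    -- 4.51 ≤ 11a.
    obtain ⟨Q, hQa, hQb⟩ := EntDetect.exists_exact_protocol P (by linarith) (by linarith)
      (by linarith)
    obtain ⟨h1, h2⟩ := (Q.completeness_soundness_iff hK hn).mpr ⟨hQa, hQb⟩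
    refine ⟨T + 1, Q, h1, h2, ?_⟩
    have h1n : 1 ≤ Real.sqrt n := Real.one_le_sqrt.mpr (by exact_mod_cast (by omega : 1 ≤ n))
    push_cast
    linarith
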